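/- **Setting.** A base station has an $N_{\rm th}\times N_{\rm tv}$ transmit and an $N_{\rm rh}\times N_{\rm rv}$ receive uniform planar array, $N_t=N_{\rm th}N_{\rm tv}$, $N_r=N_{\rm rh}N_{\rm rv}$. The transmit steering vector is $\mathbf a(\theta,\phi)=\mathbf a_h\otimes\mathbf a_v$ with entries $e^{j\pi u\sin\theta\sin\phi}$, $u=-\tfrac{N_{\rm th}-1}2,\dots,\tfrac{N_{\rm th}-1}2$, and $e^{j\pi u\cos\phi}$, $u=-\tfrac{N_{\rm tv}-1}2,\dots,\tfrac{N_{\rm tv}-1}2$, respectively; the receive steering vector $\mathbf b(\theta,\phi)$ is defined in the same way from $N_{\rm rh},N_{\rm rv}$. Write $\mathbf a,\mathbf b$ for the values at $(\theta,\phi)$, $\dot{\mathbf a}_\theta,\dot{\mathbf a}_\phi,\dot{\mathbf b}_\theta,\dot{\mathbf b}_\phi$ for the partial derivatives there, and let $\mathbf v=\mathbf a(\tilde\theta,\tilde\phi)$ for arbitrary angles $\tilde\theta,\tilde\phi$. Let $\hat{\mathbf H}=[\hat{\mathbf h}_1,\dots,\hat{\mathbf h}_K]$ be the random channel estimate with $\hat{\mathbf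 h}_k\sim\mathcal{CN}(\mathbf 0,\xi_k\mathbf I_{N_t})$, $\xi_k>0$; for ZF the columns are independent and $K<N_t$. Let $\mathbf W_{\rm MRT}=\hat{\mathbf H}$, $\mathbf W_{\rm ZF}=\hat{\mathbf H}(\hat{\mathbf H}^{\mathsf H}\hat{\mathbf H})^{-1}$, and for ${\rm bf}\in\{{\rm MRT},{\rm ZF}\}$ and powers $\gamma_k,\eta_k\ge 0$ let $$\mathbf F_{\rm bf}=\mathbf W_{\rm bf}\,\mathrm{diag}(\sqrt{\gamma_1},\dots,\sqrt{\gamma_K})+\mathbf v\,[\sqrt{\eta_1},\dots,\sqrt{\eta_K}],\qquad \rho=\sum_k\eta_k .$$ The waveform is $\mathbf X=\mathbf F_{\rm bf}\mathbf S\in\mathbb C^{N_t\times L}$, $L\ge1$, where the random symbol matrix $\mathbf S=[\mathbf s_1,\dots,\mathbf s_L]$ is independent of $\hat{\mathbf H}$, has square-integrable entries, and satisfies $\mathbb E[\mathbf s_\ell\mathbf s_\ell^{\mathsf H}]=\mathbf I_K$ for each $\ell$. Let $\boldsymbol\xi_{\rm MRT}=[\xi_1,\dots,\xi_K]^{\mathsf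 T}$, $\boldsymbol\xi_{\rm ZF}=\frac1{N_t(N_t-K)}[\frac1{\xi_1},\dots,\frac1{\xi_K}]^{\mathsf T}$, and $\boldsymbol\gamma=[\gamma_1,\dots,\gamma_K]^{\mathsf T}$. The radar observation is $\mathbf Y=\alpha\,\mathbf b\mathbf a^{\mathsf H}\mathbf X+\mathbf N$ with i.i.d. $\mathcal{CN}(0,\sigma_s^2)$ noise, $\sigma_s^2>0$, and $\kappa=2L/\sigma_s^2$. Let $\mathbf J$ be the $4\times4$ Fisher information matrix of $(\theta,\phi,\mathrm{Re}\,\alpha,\mathrm{Im}\,\alpha)$ averaged over $\mathbf X$, that is, $\mathbf J_{mn}=\frac2{\sigma_s^2}\mathbb E\,\mathrm{Re}\big((\partial_m\mathbf x)^{\mathsf H}\partial_n\mathbf x\big)$ with $\mathbf x=\mathrm{vec}(\alpha\mathbf b\mathbf a^{\mathsf H}\mathbf X)$. Denote its entries in the $(\theta,\phi)$ block by $J_{\theta\theta},J_{\theta\phi},J_{\phi\phi}$, its $2\times2$ block for $\bar{\boldsymbol\alpha}=(\mathrm{Re}\,\alpha,\mathrm{Im}\,\alpha)$ by $\mathbf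 J_{\bar\alpha\bar\alpha}$, and its row coupling $\phi$ with $\bar{\boldsymbol\alpha}$ by $\mathbf j_{\phi\bar\alpha}$. Put $$\tilde J_{\phi\bar\alpha}=J_{\phi\phi}-\mathbf j_{\phi\bar\alpha}\mathbf J_{\bar\alpha\bar\alpha}^{-1}\mathbf j_{\phi\bar\alpha}^{\mathsf T},\qquad \mathbf J_{\theta,\phi}=\begin{bmatrix}J_{\theta\theta}&J_{\theta\phi}\\J_{\theta\phi}&\tilde J_{\phi\bar\alpha}\end{bmatrix}.$$ The CRLBs considered here are by definition $\mathrm{CRLB}_\theta=[\mathbf J_{\theta,\phi}^{-1}]_{11}$ and $\mathrm{CRLB}_\phi=[\mathbf J_{\theta,\phi}^{-1}]_{22}$. (The coupling of $\theta$ with $\bar{\boldsymbol\alpha}$ is left out of this $\mathbf J_{\theta,\phi}$; it coincides with the full Schur complement of $\mathbf J_{\bar\alpha\bar\alpha}$ in $\mathbf J$ when that coupling vanishes, e.g. for $\mathbf v=\mathbf a$.) **Theorem.** For both ${\rm bf}={\rm MRT}$ and ${\rm bf}={\rm ZF}$: 1. The entries of $\mathbf F_{\rm bf}\mathbf F_{\rm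 bf}^{\mathsf H}$ and of $\mathbf X\mathbf X^{\mathsf H}$ are integrable, and the transmit covariance is $$\tfrac1L\mathbb E[\mathbf X\mathbf X^{\mathsf H}]=\mathbb E[\mathbf F_{\rm bf}\mathbf F_{\rm bf}^{\mathsf H}]=(\boldsymbol\xi_{\rm bf}^{\mathsf T}\boldsymbol\gamma)\,\mathbf I_{N_t}+\rho\,\mathbf v\mathbf v^{\mathsf H}.$$ 2. The Fisher information has the closed-form entries $$J_{\theta\theta}=\kappa|\alpha|^2\Big(\boldsymbol\xi_{\rm bf}^{\mathsf T}\boldsymbol\gamma\,(N_r\|\dot{\mathbf a}_\theta\|^2+N_t\|\dot{\mathbf b}_\theta\|^2)+\rho\,(|\mathbf v^{\mathsf H}\mathbf a|^2\|\dot{\mathbf b}_\theta\|^2+N_r|\mathbf v^{\mathsf H}\dot{\mathbf a}_\theta|^2)\Big),$$ $$J_{\phi\phi}=\kappa|\alpha|^2\Big(\boldsymbol\xi_{\rm bf}^{\mathsf T}\boldsymbol\gamma\,(N_r\|\dot{\mathbf a}_\phi\|^2+N_t\|\dot{\mathbf b}_\phi\|^2)+\rho\,(|\mathbf v^{\mathsf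 H}\mathbf a|^2\|\dot{\mathbf b}_\phi\|^2+N_r|\mathbf v^{\mathsf H}\dot{\mathbf a}_\phi|^2)\Big),$$ $$J_{\theta\phi}=J_{\phi\theta}=\kappa|\alpha|^2\Big(\boldsymbol\xi_{\rm bf}^{\mathsf T}\boldsymbol\gamma\,(N_r\dot{\mathbf a}_\theta^{\mathsf H}\dot{\mathbf a}_\phi+N_t\dot{\mathbf b}_\theta^{\mathsf H}\dot{\mathbf b}_\phi)+\rho\,(|\mathbf v^{\mathsf H}\mathbf a|^2\,\dot{\mathbf b}_\phi^{\mathsf H}\dot{\mathbf b}_\theta+N_r\,\dot{\mathbf a}_\theta^{\mathsf H}\mathbf v\mathbf v^{\mathsf H}\dot{\mathbf a}_\phi)\Big),$$ $$\mathbf J_{\bar\alpha\bar\alpha}=\kappa\big(\boldsymbol\xi_{\rm bf}^{\mathsf T}\boldsymbol\gamma\,N_tN_r+\rho N_r|\mathbf v^{\mathsf H}\mathbf a|^2\big)\mathbf I_2,\qquad \mathbf j_{\phi\bar\alpha}=\kappa\rho N_r\,\mathrm{Re}\big(\alpha^*\,\mathbf a^{\mathsf H}\mathbf v\mathbf v^{\mathsf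 H}\dot{\mathbf a}_\phi\,[1,j]\big).$$ 3. If $\mathbf J_{\bar\alpha\bar\alpha}$ and $\mathbf J_{\theta,\phi}$ are invertible, then $$\mathrm{CRLB}_\theta=\Big(J_{\theta\theta}-\frac{J_{\theta\phi}^2}{\tilde J_{\phi\bar\alpha}}\Big)^{-1}\ \text{ if }\tilde J_{\phi\bar\alpha}\ne0,\qquad \mathrm{CRLB}_\phi=\Big(\tilde J_{\phi\bar\alpha}-\frac{J_{\theta\phi}^2}{J_{\theta\theta}}\Big)^{-1}\ \text{ if }J_{\theta\theta}\ne0 .$$ If some $\gamma_k>0$, then invertibility of $\mathbf J_{\theta,\phi}$ already implies that $\mathbf J_{\bar\alpha\bar\alpha}$ is invertible and that $\tilde J_{\phi\bar\alpha}$ and $J_{\theta\theta}$ are nonzero. -/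

import Mathlib

open MeasureTheory ProbabilityTheory
open scoped NNReal Matrix

namespace ISAC

noncomputable section

/-! ### Array geometry -/

/-- Response of a centred, half-wavelength uniform linear array with `N` elements at spatial
frequency `s`: the `i`-th entry is `exp (j π (i - (N - 1) / 2) s)`, `i = 0, …, N - 1`. -/
def ulaResponse (N : ℕ) (s : ℝ) (i : Fin N) : ℂ :=
  Complex.exp (Complex.I * (Real.pi * ((i : ℝ) - ((N : ℝ) - 1) / 2) * s : ℝ))

/-- Steering vector of an `Nh × Nv` uniform planar array at azimuth `θ` and elevation `φ`: the
Kronecker product of the horizontal response (spatial frequency `sin θ sin φ`) and the vertical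
response (spatial frequency `cos φ`). Antennas are indexed by `Fin Nh × Fin Nv`. -/
def steer (Nh Nv : ℕ) (θ φ : ℝ) (i : Fin Nh × Fin Nv) : ℂ :=
  ulaResponse Nh (Real.sin θ * Real.sin φ) i.1 * ulaResponse Nv (Real.cos φ) i.2

/-- Entrywise partial derivative of the steering vector in the azimuth. -/
def steerDerivAz (Nh Nv : ℕ) (θ φ : ℝ) (i : Fin Nh × Fin Nv) : ℂ :=
  deriv (fun t : ℝ => steer Nh Nv t φ i) θ

/-- Entrywise partial derivative of the steering vector in the elevation. -/
def steerDerivEl (Nh Nv : ℕ) (θ φ : ℝ) (i : Fin Nh × Fin Nv) : ℂ :=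
  deriv (fun t : ℝ => steer Nh Nv θ t i) φ

/-- The product `xᴴ y` of two complex vectors. -/
def herm {ι : Type*} [Fintype ι] (x y : ι → ℂ) : ℂ := star x ⬝ᵥ y

/-- The squared Euclidean norm of a complex vector. -/
def normSqVec {ι : Type*} [Fintype ι] (x : ι → ℂ) : ℝ := ∑ i, ‖x i‖ ^ 2

/-! ### Channel estimates and precoding -/

/-- The circularly-symmetric complex Gaussian law `CN(0, v)` on `ℂ`. -/
def complexGaussian (v : ℝ≥0) : Measure ℂ :=
  ((gaussianReal 0 (v / 2)).prod (gaussianReal 0 (v / 2))).map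
    (fun p : ℝ × ℝ => (p.1 : ℂ) + (p.2 : ℂ) * Complex.I)

/-- The law `CN(0, v I)` of a complex Gaussian vector with independent `CN(0, v)` entries. -/
def complexGaussianVec (ι : Type*) [Fintype ι] (v : ℝ≥0) : Measure (ι → ℂ) :=
  Measure.pi (fun _ => complexGaussian v)

/-- The two linear precoding schemes: maximum-ratio transmission and zero-forcing. -/
inductive Scheme where
  | MRT
  | ZF

/-- The communications precoder computed from the channel estimate `H`:
`H` for MRT and `H (Hᴴ H)⁻¹` for ZF. -/
def commPrecoder {ι : Type*} [Fintype ι] {K : ℕ} (bf : Scheme) (H : Matrix ι (Fin K) ℂ) :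
    Matrix ι (Fin K) ℂ :=
  match bf with
  | .MRT => H
  | .ZF => H * (Hᴴ * H)⁻¹

/-- The dual-functional precoder `F = W Γ + v η̄ᵀ`, with `Γ = diag (√γ₁, …, √γ_K)` and
`η̄ = (√η₁, …, √η_K)`. -/
def precoder {ι : Type*} [Fintype ι] {K : ℕ} (bf : Scheme) (γ η : Fin K → ℝ) (v : ι → ℂ)
    (H : Matrix ι (Fin K) ℂ) : Matrix ι (Fin K) ℂ :=
  commPrecoder bf H * Matrix.diagonal (fun k => (Real.sqrt (γ k) : ℂ)) +
    Matrix.vecMulVec v (fun k => (Real.sqrt (η k) : ℂ))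

/-- The vector `ξ_bf`, for `Nt` transmit antennas and channel-estimate variances `ξ`. -/
def xiBf {K : ℕ} (bf : Scheme) (Nt : ℕ) (ξ : Fin K → ℝ≥0) (k : Fin K) : ℝ :=
  match bf with
  | .MRT => (ξ k : ℝ)
  | .ZF => 1 / ((Nt : ℝ) * ((Nt : ℝ) - (K : ℝ))) * (1 / (ξ k : ℝ))

/-- Entrywise expectation of a random matrix. -/
def matExp {Ω ι κ : Type*} [MeasurableSpace Ω] (P : Measure Ω) (M : Ω → Matrix ι κ ℂ) :
    Matrix ι κ ℂ :=
  Matrix.of (fun i j => ∫ ω, M ω i j ∂P)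

/-- `E[F Fᴴ]` for a random precoder `F`. -/
def precoderCov {Ω ι : Type*} [MeasurableSpace Ω] {K : ℕ}
    (P : Measure Ω) (F : Ω → Matrix ι (Fin K) ℂ) : Matrix ι ι ℂ :=
  matExp P (fun ω => F ω * (F ω)ᴴ)

/-- The transmit covariance `(1 / L) E[X Xᴴ]` of a random waveform `X` with `L` time slots. -/
def transmitCov {Ω ι : Type*} [MeasurableSpace Ω] {L : ℕ}
    (P : Measure Ω) (X : Ω → Matrix ι (Fin L) ℂ) : Matrix ι ι ℂ :=
  (1 / (L : ℂ)) • matExp P (fun ω => X ω * (X ω)ᴴ)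

/-! ### Radar model and Fisher information -/

/-- The two-way channel `G = b aᴴ` with an `Nth × Ntv` transmit and an `Nrh × Nrv` receive
array. -/
def twoWay (Nth Ntv Nrh Nrv : ℕ) (θ φ : ℝ) :
    Matrix (Fin Nrh × Fin Nrv) (Fin Nth × Fin Ntv) ℂ :=
  Matrix.vecMulVec (steer Nrh Nrv θ φ) (star (steer Nth Ntv θ φ))

/-- The noiseless echo `α G(θ, φ) X` as a function of the real parameter vector
`p = (θ, φ, Re α, Im α)`. -/
def echo {Nth Ntv Nrh Nrv L : ℕ} (p : Fin 4 → ℝ) (X : Matrix (Fin Nth × Fin Ntv) (Fin L) ℂ) :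
    Matrix (Fin Nrh × Fin Nrv) (Fin L) ℂ :=
  ((p 2 : ℂ) + (p 3 : ℂ) * Complex.I) • (twoWay Nth Ntv Nrh Nrv (p 0) (p 1) * X)

/-- Partial derivative of the noiseless echo in the `m`-th real parameter. -/
def echoDeriv {Nth Ntv Nrh Nrv L : ℕ} (p : Fin 4 → ℝ) (m : Fin 4)
    (X : Matrix (Fin Nth × Fin Ntv) (Fin L) ℂ) : Matrix (Fin Nrh × Fin Nrv) (Fin L) ℂ :=
  Matrix.of (fun n l => deriv
    (fun t : ℝ => (echo (Function.update p m t) X : Matrix (Fin Nrh × Fin Nrv) (Fin L) ℂ) n l)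
    (p m))

/-- The Fisher information matrix of `(θ, φ, Re α, Im α)` in the observation
`α G(θ, φ) X + N` with independent `CN(0, σ2)` noise entries,
`(2 / σ2) Re ((∂x)ᴴ (∂x))` with `x` the vectorised noiseless echo, averaged over the random
transmit waveform `X`. -/
def fisher {Ω : Type*} [MeasurableSpace Ω] {Nth Ntv L : ℕ} (Nrh Nrv : ℕ) (P : Measure Ω)
    (X : Ω → Matrix (Fin Nth × Fin Ntv) (Fin L) ℂ) (σ2 θ φ : ℝ) (α : ℂ) :
    Matrix (Fin 4) (Fin 4) ℝ :=
  Matrix.of (fun m m' => ∫ ω, 2 / σ2 * (∑ n : Fin Nrh × Fin Nrv, ∑ l : Fin L,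
    star (echoDeriv ![θ, φ, α.re, α.im] m (X ω) n l) *
      echoDeriv ![θ, φ, α.re, α.im] m' (X ω) n l).re ∂P)

/-- The row `j_{φ ᾱ}` of the Fisher information matrix. -/
def jPhiAlpha (J : Matrix (Fin 4) (Fin 4) ℝ) : Fin 2 → ℝ := ![J 1 2, J 1 3]

/-- The block `J_{ᾱ ᾱ}` of the Fisher information matrix. -/
def jAlphaAlpha (J : Matrix (Fin 4) (Fin 4) ℝ) : Matrix (Fin 2) (Fin 2) ℝ :=
  !![J 2 2, J 2 3; J 3 2, J 3 3]

/-- `J̃_{φ ᾱ} = J_{φφ} - j_{φ ᾱ} J_{ᾱ ᾱ}⁻¹ j_{φ ᾱ}ᵀ`. -/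
def jTilde (J : Matrix (Fin 4) (Fin 4) ℝ) : ℝ :=
  J 1 1 - jPhiAlpha J ⬝ᵥ ((jAlphaAlpha J)⁻¹ *ᵥ jPhiAlpha J)

/-- The equivalent Fisher information matrix of `(θ, φ)` used here: `α` is eliminated through its
coupling with `φ` (the coupling block `j_{θ ᾱ}` does not enter). -/
def equivFisher (J : Matrix (Fin 4) (Fin 4) ℝ) : Matrix (Fin 2) (Fin 2) ℝ :=
  !![J 0 0, J 0 1; J 0 1, jTilde J]

/-- The CRLB of the azimuth: first diagonal entry of the inverse of `equivFisher`. -/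
def crlbAz (J : Matrix (Fin 4) (Fin 4) ℝ) : ℝ := (equivFisher J)⁻¹ 0 0

/-- The CRLB of the elevation: second diagonal entry of the inverse of `equivFisher`. -/
def crlbEl (J : Matrix (Fin 4) (Fin 4) ℝ) : ℝ := (equivFisher J)⁻¹ 1 1

end

end ISAC

/-! The Fisher information is linear in the transmit covariance `R`: each derivative of the echo is
`D X` with `D` deterministic, so the entries are `κ Re tr(Dₙ R Dₘᴴ)` (`fisher_apply`). Everything
therefore rests on computing `R`, evaluating these traces, and two-by-two linear algebra.

For `R`: the symbols are white and independent of the precoder, so `R` is the sum over `k` of the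
second moments of the single columns of `F`. Correlations between different columns never enter. The
communications columns have mean zero, which removes their cross terms with `v`. What remains is to
show that each of them has a scalar covariance. For MRT this is the Gaussian assumption. For ZF,
left multiplication of the channels by a unitary preserves their law and multiplies the beamformer
by that unitary, so the law of the beamformer is unitarily invariant. Sign flips and coordinate
swaps then force mean zero and covariance `(E‖w‖² / Nt) I` (`moments_of_unitary_invariant`).

The value of `E‖w‖²` is geometric. The ZF beamformer is a dual basis vector, so `‖w‖²` is the
inverse squared distance from its channel to the span of the others (`normSqVec_zfCol`). Given the
others, the component of that channel in their orthogonal complement is complex Gaussian of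
dimension `m = Nt - K + 1` (`map_mulVec_complexGaussianVec`). Its inverse moment `1 / (ξ (m - 1))`
comes from `1/q = ∫ exp(-tq) dt` and the Laplace transform `(1 + tξ)^(-m)`
(`lintegral_inv_normSqVec`).

For the traces: the arrays are centred, so index reversal conjugates steering vectors and their
derivatives. Hence a steering vector is orthogonal to its own derivatives, and the products between
these vectors are real. The first fact removes the mixed terms; the second allows the entry `J 0 1`
to be stated without a real part (`fisher_entries`).

For the nonvanishing claims: the loss from eliminating `α` is at most the `ρ`-part of `J 1 1`. If
`J̃` or `J 0 0` vanished, the isotropic part would force the corresponding array derivatives to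
vanish, hence `J 0 1 = 0` and a zero determinant (`denominators_ne_zero`). -/

namespace ISAC

/-! ### Steering vectors -/

section Steering

variable {Nh Nv : ℕ}

/-- The centred position of the `i`-th element of a uniform linear array. -/
noncomputable def centredPos (N : ℕ) (i : Fin N) : ℝ := (i : ℝ) - ((N : ℝ) - 1) / 2

/-- The azimuth derivative of the phase of the steering vector. -/
noncomputable def phaseAz (θ φ : ℝ) (i : Fin Nh × Fin Nv) : ℝ :=
  Real.pi * centredPos Nh i.1 * (Real.cos θ * Real.sin φ)

/-- The elevation derivative of the phase of the steering vector. -/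
noncomputable def phaseEl (θ φ : ℝ) (i : Fin Nh × Fin Nv) : ℝ :=
  Real.pi * centredPos Nh i.1 * (Real.sin θ * Real.cos φ) -
    Real.pi * centredPos Nv i.2 * Real.sin φ

/-- The reversal of both antenna indices. -/
def revIdx : Fin Nh × Fin Nv ≃ Fin Nh × Fin Nv := Equiv.prodCongr Fin.revPerm Fin.revPerm

/-- Centring at `(N - 1) / 2` is what makes positions odd under reversal; the orthogonality and
reality facts below all derive from this. -/
lemma centredPos_rev (N : ℕ) (i : Fin N) : centredPos N i.rev = -centredPos N i := by
  have h : (i.rev : ℕ) + i + 1 = N := by rw [Fin.val_rev]; omega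
  have h' : ((i.rev : ℕ) : ℝ) + (i : ℕ) + 1 = N := by exact_mod_cast h
  unfold centredPos
  linarith

lemma phaseAz_revIdx (θ φ : ℝ) (i : Fin Nh × Fin Nv) :
    phaseAz θ φ (revIdx i) = -phaseAz θ φ i := by
  simp [phaseAz, revIdx, centredPos_rev]

lemma phaseEl_revIdx (θ φ : ℝ) (i : Fin Nh × Fin Nv) :
    phaseEl θ φ (revIdx i) = -phaseEl θ φ i := by
  simp [phaseEl, revIdx, centredPos_rev]; ring

lemma ulaResponse_rev (N : ℕ) (s : ℝ) (i : Fin N) :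
    ulaResponse N s i.rev = star (ulaResponse N s i) := by
  have h := centredPos_rev N i
  unfold centredPos at h
  unfold ulaResponse
  rw [h, Complex.star_def, ← Complex.exp_conj]
  congr 1
  simp only [map_mul, Complex.conj_I, Complex.conj_ofReal]
  push_cast
  ring

lemma steer_revIdx (θ φ : ℝ) (i : Fin Nh × Fin Nv) :
    steer Nh Nv θ φ (revIdx i) = star (steer Nh Nv θ φ i) := by
  simp [steer, revIdx, ulaResponse_rev]

lemma star_ulaResponse_mul_self (N : ℕ) (s : ℝ) (i : Fin N) :
    star (ulaResponse N s i) * ulaResponse N s i = 1 := by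
  unfold ulaResponse
  rw [Complex.star_def, ← Complex.exp_conj, ← Complex.exp_add]
  simp only [map_mul, Complex.conj_I, Complex.conj_ofReal]
  simp

lemma star_steer_mul_self (θ φ : ℝ) (i : Fin Nh × Fin Nv) :
    star (steer Nh Nv θ φ i) * steer Nh Nv θ φ i = 1 := by
  have h1 := star_ulaResponse_mul_self Nh (Real.sin θ * Real.sin φ) i.1
  have h2 := star_ulaResponse_mul_self Nv (Real.cos φ) i.2
  simp only [steer, star_mul]
  linear_combination
    (star (ulaResponse Nv (Real.cos φ) i.2) * ulaResponse Nv (Real.cos φ) i.2) * h1 + h2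

lemma hasDerivAt_ulaResponse (N : ℕ) {s : ℝ → ℝ} {s' t : ℝ} (hs : HasDerivAt s s' t) (i : Fin N) :
    HasDerivAt (fun t => ulaResponse N (s t) i)
      (Complex.I * (Real.pi * centredPos N i * s' : ℝ) * ulaResponse N (s t) i) t := by
  unfold ulaResponse centredPos
  have h := ((hs.const_mul (Real.pi * ((i : ℝ) - ((N : ℝ) - 1) / 2))).ofReal_comp.const_mul
    Complex.I).cexp
  convert h using 1
  ring

lemma hasDerivAt_steer_az (θ φ : ℝ) (i : Fin Nh × Fin Nv) :
    HasDerivAt (fun t => steer Nh Nv t φ i)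
      (Complex.I * (phaseAz θ φ i : ℝ) * steer Nh Nv θ φ i) θ := by
  have h := (hasDerivAt_ulaResponse Nh
    ((Real.hasDerivAt_sin θ).mul_const (Real.sin φ)) i.1).mul_const
    (ulaResponse Nv (Real.cos φ) i.2)
  refine h.congr_deriv ?_
  simp only [phaseAz, steer]
  push_cast
  ring

lemma hasDerivAt_steer_el (θ φ : ℝ) (i : Fin Nh × Fin Nv) :
    HasDerivAt (fun t => steer Nh Nv θ t i)
      (Complex.I * (phaseEl θ φ i : ℝ) * steer Nh Nv θ φ i) φ := by
  have h := (hasDerivAt_ulaResponse Nh ((Real.hasDerivAt_sin φ).const_mul (Real.sin θ)) i.1).mul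
    (hasDerivAt_ulaResponse Nv (Real.hasDerivAt_cos φ) i.2)
  refine h.congr_deriv ?_
  simp only [phaseEl, steer]
  push_cast
  ring

lemma steerDerivAz_apply (θ φ : ℝ) (i : Fin Nh × Fin Nv) :
    steerDerivAz Nh Nv θ φ i = Complex.I * (phaseAz θ φ i : ℝ) * steer Nh Nv θ φ i :=
  (hasDerivAt_steer_az θ φ i).deriv

lemma steerDerivEl_apply (θ φ : ℝ) (i : Fin Nh × Fin Nv) :
    steerDerivEl Nh Nv θ φ i = Complex.I * (phaseEl θ φ i : ℝ) * steer Nh Nv θ φ i :=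
  (hasDerivAt_steer_el θ φ i).deriv

lemma steerDerivAz_revIdx (θ φ : ℝ) (i : Fin Nh × Fin Nv) :
    steerDerivAz Nh Nv θ φ (revIdx i) = star (steerDerivAz Nh Nv θ φ i) := by
  simp [steerDerivAz_apply, phaseAz_revIdx, steer_revIdx]

lemma steerDerivEl_revIdx (θ φ : ℝ) (i : Fin Nh × Fin Nv) :
    steerDerivEl Nh Nv θ φ (revIdx i) = star (steerDerivEl Nh Nv θ φ i) := by
  simp [steerDerivEl_apply, phaseEl_revIdx, steer_revIdx]

lemma star_herm {ι : Type*} [Fintype ι] (x y : ι → ℂ) : star (herm x y) = herm y x := by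
  simp [herm, dotProduct, mul_comm]

lemma herm_self {ι : Type*} [Fintype ι] (x : ι → ℂ) : herm x x = (normSqVec x : ℂ) := by
  simp [herm, dotProduct, normSqVec, ← Complex.conj_mul']

lemma normSqVec_nonneg {ι : Type*} [Fintype ι] (x : ι → ℂ) : 0 ≤ normSqVec x :=
  Finset.sum_nonneg fun _ _ => by positivity

lemma eq_zero_of_normSqVec_eq_zero {ι : Type*} [Fintype ι] {x : ι → ℂ} (h : normSqVec x = 0) :
    x = 0 := by
  funext i
  have := (Finset.sum_eq_zero_iff_of_nonneg (fun i _ => by positivity)).1 h i (Finset.mem_univ i)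
  simpa using this

/-- The product of two vectors that are conjugate-symmetric under index reversal is real. -/
lemma star_herm_eq_self {x y : Fin Nh × Fin Nv → ℂ} (hx : ∀ i, x (revIdx i) = star (x i))
    (hy : ∀ i, y (revIdx i) = star (y i)) : star (herm x y) = herm x y := by
  unfold herm dotProduct
  rw [star_sum, ← Equiv.sum_comp revIdx (fun i => star x i * y i)]
  refine Finset.sum_congr rfl fun i _ => ?_
  simp [hx, hy, mul_comm]

lemma herm_steer_self (θ φ : ℝ) :
    herm (steer Nh Nv θ φ) (steer Nh Nv θ φ) = (Nh : ℂ) * Nv := by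
  simp only [herm, dotProduct, Pi.star_apply, star_steer_mul_self]
  simp

lemma sum_eq_zero_of_odd {f : Fin Nh × Fin Nv → ℝ} (hf : ∀ i, f (revIdx i) = -f i) :
    ∑ i, f i = 0 := by
  have h := Equiv.sum_comp revIdx f
  simp only [hf, Finset.sum_neg_distrib] at h
  linarith

/-- Unimodular entries cancel, leaving `i ∑ f`, and an odd function sums to zero. -/
lemma herm_steer_of_phase {θ φ : ℝ} {f : Fin Nh × Fin Nv → ℝ} {y : Fin Nh × Fin Nv → ℂ}
    (hf : ∀ i, f (revIdx i) = -f i) (hy : ∀ i, y i = Complex.I * (f i : ℝ) * steer Nh Nv θ φ i) :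
    herm (steer Nh Nv θ φ) y = 0 := by
  have h : ∀ i, star (steer Nh Nv θ φ i) * y i = Complex.I * (f i : ℝ) := fun i => by
    rw [hy]
    linear_combination (Complex.I * (f i : ℝ)) * star_steer_mul_self θ φ i
  simp only [herm, dotProduct, Pi.star_apply, h]
  rw [← Finset.mul_sum, ← Complex.ofReal_sum, sum_eq_zero_of_odd hf]
  simp

lemma herm_steer_steerDerivAz (θ φ : ℝ) :
    herm (steer Nh Nv θ φ) (steerDerivAz Nh Nv θ φ) = 0 :=
  herm_steer_of_phase (phaseAz_revIdx θ φ) (steerDerivAz_apply θ φ)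

lemma herm_steer_steerDerivEl (θ φ : ℝ) :
    herm (steer Nh Nv θ φ) (steerDerivEl Nh Nv θ φ) = 0 :=
  herm_steer_of_phase (phaseEl_revIdx θ φ) (steerDerivEl_apply θ φ)

end Steering

/-! ### Fisher information in terms of the transmit covariance -/

section Fisher

variable {Nth Ntv Nrh Nrv L : ℕ}

/-- The matrix `D` with `∂ₘ (α G X) = D X` for the `m`-th real parameter. -/
noncomputable def channelDeriv (Nth Ntv Nrh Nrv : ℕ) (θ φ : ℝ) (α : ℂ) (m : Fin 4) :
    Matrix (Fin Nrh × Fin Nrv) (Fin Nth × Fin Ntv) ℂ :=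
  ![α • (Matrix.vecMulVec (steerDerivAz Nrh Nrv θ φ) (star (steer Nth Ntv θ φ)) +
      Matrix.vecMulVec (steer Nrh Nrv θ φ) (star (steerDerivAz Nth Ntv θ φ))),
    α • (Matrix.vecMulVec (steerDerivEl Nrh Nrv θ φ) (star (steer Nth Ntv θ φ)) +
      Matrix.vecMulVec (steer Nrh Nrv θ φ) (star (steerDerivEl Nth Ntv θ φ))),
    twoWay Nth Ntv Nrh Nrv θ φ, Complex.I • twoWay Nth Ntv Nrh Nrv θ φ] m

lemma hasDerivAt_twoWay_az (θ φ : ℝ) (n : Fin Nrh × Fin Nrv) (i : Fin Nth × Fin Ntv) :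
    HasDerivAt (fun t => twoWay Nth Ntv Nrh Nrv t φ n i)
      ((Matrix.vecMulVec (steerDerivAz Nrh Nrv θ φ) (star (steer Nth Ntv θ φ)) +
      Matrix.vecMulVec (steer Nrh Nrv θ φ) (star (steerDerivAz Nth Ntv θ φ))) n i) θ := by
  have h := (hasDerivAt_steer_az θ φ n).mul (hasDerivAt_steer_az θ φ i).star
  refine h.congr_deriv ?_
  simp [Matrix.vecMulVec_apply, steerDerivAz_apply]

lemma hasDerivAt_twoWay_el (θ φ : ℝ) (n : Fin Nrh × Fin Nrv) (i : Fin Nth × Fin Ntv) :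
    HasDerivAt (fun t => twoWay Nth Ntv Nrh Nrv θ t n i)
      ((Matrix.vecMulVec (steerDerivEl Nrh Nrv θ φ) (star (steer Nth Ntv θ φ)) +
      Matrix.vecMulVec (steer Nrh Nrv θ φ) (star (steerDerivEl Nth Ntv θ φ))) n i) φ := by
  have h := (hasDerivAt_steer_el θ φ n).mul (hasDerivAt_steer_el θ φ i).star
  refine h.congr_deriv ?_
  simp [Matrix.vecMulVec_apply, steerDerivEl_apply]

lemma hasDerivAt_scaled_twoWay (θ φ : ℝ) (α : ℂ) (m : Fin 4) (n : Fin Nrh × Fin Nrv)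
    (i : Fin Nth × Fin Ntv) :
    HasDerivAt (fun t : ℝ =>
      ((Function.update ![θ, φ, α.re, α.im] m t 2 : ℝ) +
        (Function.update ![θ, φ, α.re, α.im] m t 3 : ℝ) * Complex.I) *
      twoWay Nth Ntv Nrh Nrv (Function.update ![θ, φ, α.re, α.im] m t 0)
        (Function.update ![θ, φ, α.re, α.im] m t 1) n i)
      (channelDeriv Nth Ntv Nrh Nrv θ φ α m n i) (![θ, φ, α.re, α.im] m) := by
  have hα : (α.re : ℂ) + α.im * Complex.I = α := Complex.re_add_im α
  fin_cases m
  · simpa [Function.update, channelDeriv, hα, mul_add] using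
      (hasDerivAt_twoWay_az θ φ n i).const_mul α
  · simpa [Function.update, channelDeriv, hα, mul_add] using
      (hasDerivAt_twoWay_el θ φ n i).const_mul α
  · simp only [Fin.reduceFinMk, Function.update, channelDeriv]
    simpa using ((Complex.ofRealCLM.hasDerivAt (x := α.re)).add_const
      ((α.im : ℂ) * Complex.I)).mul_const (twoWay Nth Ntv Nrh Nrv θ φ n i)
  · simp only [Fin.reduceFinMk, Function.update, channelDeriv]
    simpa using (((Complex.ofRealCLM.hasDerivAt (x := α.im)).mul_const Complex.I).const_add
      (α.re : ℂ)).mul_const (twoWay Nth Ntv Nrh Nrv θ φ n i)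

lemma echoDeriv_eq (θ φ : ℝ) (α : ℂ) (m : Fin 4) (X : Matrix (Fin Nth × Fin Ntv) (Fin L) ℂ) :
    (echoDeriv ![θ, φ, α.re, α.im] m X : Matrix (Fin Nrh × Fin Nrv) (Fin L) ℂ) =
      channelDeriv Nth Ntv Nrh Nrv θ φ α m * X := by
  ext n l
  have h := HasDerivAt.fun_sum (u := Finset.univ) fun i _ =>
    (hasDerivAt_scaled_twoWay θ φ α m n i : HasDerivAt _ _ _).mul_const (X i l)
  rw [Matrix.mul_apply, ← h.deriv]
  simp only [echoDeriv, Matrix.of_apply]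
  congr 1
  funext t
  simp [echo, Matrix.mul_apply, Finset.mul_sum, mul_assoc]

lemma sum_star_mul_eq_trace {ι κ : Type*} [Fintype ι] [Fintype κ] (A B : Matrix ι κ ℂ) :
    ∑ n, ∑ l, star (A n l) * B n l = (B * Aᴴ).trace := by
  simp [Matrix.trace, Matrix.mul_apply, mul_comm]

lemma trace_mul_mul {ι κ : Type*} [Fintype ι] [Fintype κ] (A B : Matrix κ ι ℂ)
    (R : Matrix ι ι ℂ) :
    (B * R * Aᴴ).trace = ∑ n, ∑ j, ∑ i, B n i * R i j * star (A n j) := by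
  simp [Matrix.trace, Matrix.mul_apply, Finset.sum_mul]

/-- The Fisher information is a linear function of the transmit covariance. -/
lemma fisher_apply {Ω : Type*} [MeasurableSpace Ω] {P : Measure Ω}
    {X : Ω → Matrix (Fin Nth × Fin Ntv) (Fin L) ℂ} (hL : 0 < L)
    (hX : ∀ i j, Integrable (fun ω => (X ω * (X ω)ᴴ) i j) P) (σ2 θ φ : ℝ) (α : ℂ) (m m' : Fin 4) :
    fisher Nrh Nrv P X σ2 θ φ α m m' = 2 * L / σ2 *
      (channelDeriv Nth Ntv Nrh Nrv θ φ α m' * transmitCov P X *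
        (channelDeriv Nth Ntv Nrh Nrv θ φ α m)ᴴ).trace.re := by
  set A := channelDeriv Nth Ntv Nrh Nrv θ φ α m
  set B := channelDeriv Nth Ntv Nrh Nrv θ φ α m'
  have h1 : ∀ ω, (∑ n : Fin Nrh × Fin Nrv, ∑ l : Fin L,
      star (echoDeriv ![θ, φ, α.re, α.im] m (X ω) n l) *
      echoDeriv ![θ, φ, α.re, α.im] m' (X ω) n l) =
      ∑ n, ∑ j, ∑ i, B n i * (X ω * (X ω)ᴴ) i j * star (A n j) := fun ω => by
    rw [sum_star_mul_eq_trace, echoDeriv_eq, echoDeriv_eq, ← trace_mul_mul,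
      Matrix.conjTranspose_mul]
    simp only [Matrix.mul_assoc, A, B]
  have hint : ∀ n j i, Integrable
      (fun ω => B n i * (X ω * (X ω)ᴴ) i j * star (A n j)) P :=
    fun n j i => ((hX i j).const_mul _).mul_const _
  -- The trace is a finite linear combination of entries of `X Xᴴ`, so the expectation passes
  -- inside; the factor `L` undoes the normalisation of `transmitCov`.
  have h2 : ∫ ω, (∑ n, ∑ j, ∑ i, B n i * (X ω * (X ω)ᴴ) i j * star (A n j)) ∂P =
      L * (B * transmitCov P X * Aᴴ).trace := by
    rw [trace_mul_mul, integral_finsetSum _ fun n _ => integrable_finsetSum _ fun j _ =>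
      integrable_finsetSum _ fun i _ => hint n j i, Finset.mul_sum]
    refine Finset.sum_congr rfl fun n _ => ?_
    rw [integral_finsetSum _ fun j _ => integrable_finsetSum _ fun i _ => hint n j i,
      Finset.mul_sum]
    refine Finset.sum_congr rfl fun j _ => ?_
    rw [integral_finsetSum _ fun i _ => hint n j i, Finset.mul_sum]
    refine Finset.sum_congr rfl fun i _ => ?_
    rw [integral_mul_const, integral_const_mul]
    have hL' : (L : ℂ) ≠ 0 := by exact_mod_cast hL.ne'
    simp only [transmitCov, matExp, Matrix.smul_apply, Matrix.of_apply, smul_eq_mul]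
    field_simp
  unfold fisher
  simp only [Matrix.of_apply, h1]
  rw [integral_const_mul]
  have h3 : ∫ ω, (∑ n, ∑ j, ∑ i, B n i * (X ω * (X ω)ᴴ) i j * star (A n j)).re ∂P =
      (∫ ω, (∑ n, ∑ j, ∑ i, B n i * (X ω * (X ω)ᴴ) i j * star (A n j)) ∂P).re :=
    integral_re (integrable_finsetSum _ fun n _ => integrable_finsetSum _ fun j _ =>
      integrable_finsetSum _ fun i _ => hint n j i)
  rw [h3, h2, ← Complex.ofReal_natCast, Complex.re_ofReal_mul]
  ring

/-- All channel derivatives are sums of rank-one matrices; each trace then splits into a receive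
factor and a transmit factor. -/
lemma trace_vecMulVec_mul_mul {ι κ : Type*} [Fintype ι] [Fintype κ] (x x' : κ → ℂ) (y y' : ι → ℂ)
    (R : Matrix ι ι ℂ) :
    (Matrix.vecMulVec x (star y) * R * (Matrix.vecMulVec x' (star y'))ᴴ).trace =
      herm x' x * herm y (R *ᵥ y') := by
  rw [Matrix.vecMulVec_mul, Matrix.conjTranspose_vecMulVec, Matrix.vecMulVec_mul_vecMulVec,
    Matrix.trace_vecMulVec, star_star, ← Matrix.dotProduct_mulVec, dotProduct_smul, smul_eq_mul,
    dotProduct_comm x, mul_comm]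
  rfl

lemma herm_mulVec {ι : Type*} [Fintype ι] [DecidableEq ι] (c ρ : ℂ) (v y y' : ι → ℂ) :
    herm y ((c • (1 : Matrix ι ι ℂ) + ρ • Matrix.vecMulVec v (star v)) *ᵥ y') =
      c * herm y y' + ρ * (herm y v * herm v y') := by
  simp only [herm, Matrix.add_mulVec, Matrix.smul_mulVec, Matrix.one_mulVec,
    Matrix.vecMulVec_mulVec, dotProduct_add, dotProduct_smul, smul_eq_mul]
  simp [mul_comm]

end Fisher

/-! ### Closed-form entries of the Fisher information. -/

section FisherEntries

variable {Nth Ntv Nrh Nrv L : ℕ}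

lemma herm_steerDerivAz_steer (θ φ : ℝ) :
    herm (steerDerivAz Nth Ntv θ φ) (steer Nth Ntv θ φ) = 0 := by
  rw [← star_herm, herm_steer_steerDerivAz, star_zero]

lemma herm_steerDerivEl_steer (θ φ : ℝ) :
    herm (steerDerivEl Nth Ntv θ φ) (steer Nth Ntv θ φ) = 0 := by
  rw [← star_herm, herm_steer_steerDerivEl, star_zero]

lemma herm_mul_herm_swap {ι : Type*} [Fintype ι] (x y : ι → ℂ) :
    herm x y * herm y x = (‖herm y x‖ : ℂ) ^ 2 := by
  rw [← star_herm y x, Complex.star_def, Complex.conj_mul']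

/-- The closed-form entries of the Fisher information for a transmit covariance
`c I + ρ v vᴴ`, where `v` is a steering vector. -/
theorem fisher_entries {Ω : Type*} [MeasurableSpace Ω] {P : Measure Ω}
    {X : Ω → Matrix (Fin Nth × Fin Ntv) (Fin L) ℂ} (hL : 0 < L)
    (hX : ∀ i j, Integrable (fun ω => (X ω * (X ω)ᴴ) i j) P) (σ2 θ φ θ' φ' : ℝ) (α : ℂ) (c ρ : ℝ)
    (hcov : transmitCov P X = (c : ℂ) • 1 + (ρ : ℂ) •
      Matrix.vecMulVec (steer Nth Ntv θ' φ') (star (steer Nth Ntv θ' φ'))) :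
    let Nt : ℝ := (Nth : ℝ) * (Ntv : ℝ)
    let Nr : ℝ := (Nrh : ℝ) * (Nrv : ℝ)
    let κ : ℝ := 2 * (L : ℝ) / σ2
    let v := steer Nth Ntv θ' φ'
    let a := steer Nth Ntv θ φ
    let aθ := steerDerivAz Nth Ntv θ φ
    let aφ := steerDerivEl Nth Ntv θ φ
    let bθ := steerDerivAz Nrh Nrv θ φ
    let bφ := steerDerivEl Nrh Nrv θ φ
    let J := fisher Nrh Nrv P X σ2 θ φ α
    J 0 0 = κ * ‖α‖ ^ 2 *
        (c * (Nr * normSqVec aθ + Nt * normSqVec bθ) +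
          ρ * (‖herm v a‖ ^ 2 * normSqVec bθ + Nr * ‖herm v aθ‖ ^ 2)) ∧
      J 1 1 = κ * ‖α‖ ^ 2 *
        (c * (Nr * normSqVec aφ + Nt * normSqVec bφ) +
          ρ * (‖herm v a‖ ^ 2 * normSqVec bφ + Nr * ‖herm v aφ‖ ^ 2)) ∧
      ((J 0 1 : ℝ) : ℂ) = (κ : ℂ) * (‖α‖ : ℂ) ^ 2 *
        ((c : ℂ) * ((Nr : ℂ) * herm aθ aφ + (Nt : ℂ) * herm bθ bφ) +
          (ρ : ℂ) * ((‖herm v a‖ : ℂ) ^ 2 * herm bφ bθ +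
            (Nr : ℂ) * (herm aθ v * herm v aφ))) ∧
      J 1 0 = J 0 1 ∧
      jAlphaAlpha J =
        (κ * (c * Nt * Nr + ρ * Nr * ‖herm v a‖ ^ 2)) • (1 : Matrix (Fin 2) (Fin 2) ℝ) ∧
      jPhiAlpha J = fun m : Fin 2 => κ * ρ * Nr *
        (star α * (herm a v * herm v aφ) * (![1, Complex.I] : Fin 2 → ℂ) m).re := by
  intro Nt Nr κ v a aθ aφ bθ bφ J
  set b := steer Nrh Nrv θ φ with hb
  set R := transmitCov P X with hR
  have hJ : ∀ m m', J m m' = κ * (channelDeriv Nth Ntv Nrh Nrv θ φ α m' * R *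
      (channelDeriv Nth Ntv Nrh Nrv θ φ α m)ᴴ).trace.re :=
    fun m m' => fisher_apply hL hX σ2 θ φ α m m'
  have D0 : channelDeriv Nth Ntv Nrh Nrv θ φ α 0 =
    α • (Matrix.vecMulVec bθ (star a) + Matrix.vecMulVec b (star aθ)) := rfl
  have D1 : channelDeriv Nth Ntv Nrh Nrv θ φ α 1 =
    α • (Matrix.vecMulVec bφ (star a) + Matrix.vecMulVec b (star aφ)) := rfl
  have D2 : channelDeriv Nth Ntv Nrh Nrv θ φ α 2 = Matrix.vecMulVec b (star a) := rfl
  have D3 : channelDeriv Nth Ntv Nrh Nrv θ φ α 3 = Complex.I • Matrix.vecMulVec b (star a) := rfl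
  have hq : ∀ y y', herm y (R *ᵥ y') = c * herm y y' + ρ * (herm y v * herm v y') := fun y y' => by
    rw [hcov, herm_mulVec]
  have hbb : herm b b = Nr := by rw [herm_steer_self]; simp [Nr]
  have haa : herm a a = Nt := by rw [herm_steer_self]; simp [Nt]
  -- The receive-side orthogonalities remove the mixed terms whatever `v` is; on the transmit side
  -- `a` is orthogonal to `aφ`, but not in general in the form weighted by `R`.
  have e1 : herm b bθ = 0 := herm_steer_steerDerivAz θ φ
  have e2 : herm bθ b = 0 := herm_steerDerivAz_steer θ φ
  have e3 : herm b bφ = 0 := herm_steer_steerDerivEl θ φ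
  have e4 : herm bφ b = 0 := herm_steerDerivEl_steer θ φ
  have e5 : herm a aφ = 0 := herm_steer_steerDerivEl θ φ
  have e6 : herm aφ a = 0 := herm_steerDerivEl_steer θ φ
  have hav : ∀ y, herm y v * herm v y = (‖herm v y‖ : ℂ) ^ 2 := fun y => herm_mul_herm_swap y v
  have hα : star α * α = (‖α‖ : ℂ) ^ 2 := Complex.conj_mul' α
  have rv := steer_revIdx (Nh := Nth) (Nv := Ntv) θ' φ'
  have raθ := steerDerivAz_revIdx (Nh := Nth) (Nv := Ntv) θ φ
  have raφ := steerDerivEl_revIdx (Nh := Nth) (Nv := Ntv) θ φ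
  have rbθ := steerDerivAz_revIdx (Nh := Nrh) (Nv := Nrv) θ φ
  have rbφ := steerDerivEl_revIdx (Nh := Nrh) (Nv := Nrv) θ φ
  -- Conjugate symmetry makes these products real, so the order of their arguments is immaterial and
  -- taking real parts loses nothing.
  have s1 : herm aφ aθ = herm aθ aφ := by rw [← star_herm, star_herm_eq_self raθ raφ]
  have s2 : herm bφ bθ = herm bθ bφ := by rw [← star_herm, star_herm_eq_self rbθ rbφ]
  have s3 : herm v aθ = herm aθ v := by rw [← star_herm, star_herm_eq_self raθ rv]
  have s4 : herm aφ v = herm v aφ := by rw [← star_herm, star_herm_eq_self rv raφ]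
  have r1 : ((herm aθ aφ).re : ℂ) = herm aθ aφ :=
    Complex.conj_eq_iff_re.1 (star_herm_eq_self raθ raφ)
  have r2 : ((herm bθ bφ).re : ℂ) = herm bθ bφ :=
    Complex.conj_eq_iff_re.1 (star_herm_eq_self rbθ rbφ)
  have r3 : ((herm aθ v).re : ℂ) = herm aθ v :=
    Complex.conj_eq_iff_re.1 (star_herm_eq_self raθ rv)
  have r4 : ((herm v aφ).re : ℂ) = herm v aφ :=
    Complex.conj_eq_iff_re.1 (star_herm_eq_self rv raφ)
  have hJ00 : J 0 0 = κ * ‖α‖ ^ 2 *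
        (c * (Nr * normSqVec aθ + Nt * normSqVec bθ) +
          ρ * (‖herm v a‖ ^ 2 * normSqVec bθ + Nr * ‖herm v aθ‖ ^ 2)) := by
    rw [hJ, D0, mul_assoc]
    congr 1
    rw [← Complex.ofReal_re (_ * _)]
    congr 1
    simp only [Matrix.conjTranspose_add, Matrix.conjTranspose_smul, Matrix.smul_mul,
      Matrix.mul_smul, Matrix.trace_smul, Matrix.add_mul, Matrix.mul_add, Matrix.trace_add,
      trace_vecMulVec_mul_mul, smul_eq_mul, hq, e1, e2, hbb, haa, hav, herm_self]
    push_cast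
    rw [← hα]
    ring
  have hJ11 : J 1 1 = κ * ‖α‖ ^ 2 *
        (c * (Nr * normSqVec aφ + Nt * normSqVec bφ) +
          ρ * (‖herm v a‖ ^ 2 * normSqVec bφ + Nr * ‖herm v aφ‖ ^ 2)) := by
    rw [hJ, D1, mul_assoc]
    congr 1
    rw [← Complex.ofReal_re (_ * _)]
    congr 1
    simp only [Matrix.conjTranspose_add, Matrix.conjTranspose_smul, Matrix.smul_mul,
      Matrix.mul_smul, Matrix.trace_smul, Matrix.add_mul, Matrix.mul_add, Matrix.trace_add,
      trace_vecMulVec_mul_mul, smul_eq_mul, hq, e3, e4, hbb, haa, hav, herm_self]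
    push_cast
    rw [← hα]
    ring
  set w : ℝ := ‖α‖ ^ 2 * (c * (Nr * (herm aθ aφ).re + Nt * (herm bθ bφ).re) +
    ρ * (‖herm v a‖ ^ 2 * (herm bθ bφ).re + Nr * ((herm aθ v).re * (herm v aφ).re))) with hw
  have hJ01 : J 0 1 = κ * w := by
    rw [hJ, D0, D1]
    congr 1
    rw [← Complex.ofReal_re w]
    congr 1
    simp only [Matrix.conjTranspose_add, Matrix.conjTranspose_smul, Matrix.smul_mul,
      Matrix.mul_smul, Matrix.trace_smul, Matrix.add_mul, Matrix.mul_add, Matrix.trace_add,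
      trace_vecMulVec_mul_mul, smul_eq_mul, hq, e2, e3, hbb, haa, hav]
    rw [hw]
    push_cast
    rw [r1, r2, r3, r4, s1, s3, s4, ← hα]
    ring
  have hJ10 : J 1 0 = κ * w := by
    rw [hJ, D0, D1]
    congr 1
    rw [← Complex.ofReal_re w]
    congr 1
    simp only [Matrix.conjTranspose_add, Matrix.conjTranspose_smul, Matrix.smul_mul,
      Matrix.mul_smul, Matrix.trace_smul, Matrix.add_mul, Matrix.mul_add, Matrix.trace_add,
      trace_vecMulVec_mul_mul, smul_eq_mul, hq, e1, e4, hbb, haa, hav]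
    rw [hw]
    push_cast
    rw [r1, r2, r3, r4, s2, ← hα]
    ring
  refine ⟨hJ00, hJ11, ?_, by rw [hJ01, hJ10], ?_, ?_⟩
  · rw [hJ01, hw]
    push_cast
    rw [r1, r2, r3, r4, s2]
    ring
  -- The off-diagonal traces are `±i` times a real number, so their real parts vanish.
  · ext i j
    fin_cases i <;> fin_cases j <;>
    · simp [jAlphaAlpha, hJ, D2, D3, trace_vecMulVec_mul_mul, hq, hbb, haa, hav, Complex.mul_re,
        Complex.mul_im, ← Complex.ofReal_pow, -Matrix.conjTranspose_vecMulVec]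
      try (left; ring)
  · funext i
    have hre : ∀ z : ℂ, (Nr * (ρ * z)).re = ρ * Nr * z.re := fun z => by
      rw [Complex.re_ofReal_mul, Complex.re_ofReal_mul]; ring
    fin_cases i
    -- The isotropic part of the covariance contributes `c aᴴ aφ = 0`, so only the `ρ` term
    -- survives.
    · simp only [jPhiAlpha, hJ, D1, D2, Matrix.conjTranspose_add, Matrix.conjTranspose_smul,
        Matrix.mul_smul, Matrix.trace_smul, Matrix.mul_add,
        Matrix.trace_add, trace_vecMulVec_mul_mul, smul_eq_mul, hq, e4, e5, hbb, zero_mul,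
        zero_add, mul_zero, Fin.zero_eta, Matrix.cons_val_zero, mul_one]
      rw [mul_left_comm, mul_left_comm (star α), hre]
      ring
    · simp only [jPhiAlpha, hJ, D1, D3, Matrix.conjTranspose_add, Matrix.conjTranspose_smul,
        Matrix.smul_mul, Matrix.mul_smul, Matrix.trace_smul, Matrix.mul_add,
        Matrix.trace_add, trace_vecMulVec_mul_mul, smul_eq_mul, hq, e4, e5, hbb, zero_mul,
        zero_add, mul_zero, Fin.mk_one, Matrix.cons_val_one, Matrix.cons_val_fin_one]
      rw [show star α * (Complex.I * (↑Nr * (↑ρ * (herm a v * herm v aφ)))) =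
        Nr * (ρ * (star α * (herm a v * herm v aφ) * Complex.I)) by ring, hre]
      ring

end FisherEntries

/-! ### The equivalent Fisher information -/

section Bounds

variable {J : Matrix (Fin 4) (Fin 4) ℝ}

lemma det_equivFisher (J : Matrix (Fin 4) (Fin 4) ℝ) :
    (equivFisher J).det = J 0 0 * jTilde J - J 0 1 ^ 2 := by
  simp [equivFisher, Matrix.det_fin_two, sq]

lemma isUnit_equivFisher_iff : IsUnit (equivFisher J) ↔ J 0 0 * jTilde J - J 0 1 ^ 2 ≠ 0 := by
  rw [Matrix.isUnit_iff_isUnit_det, det_equivFisher, isUnit_iff_ne_zero]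

/-- Cofactor formula for a two-by-two inverse; at determinant zero both sides take the default value
`0`. -/
lemma crlbAz_eq_schur (h : jTilde J ≠ 0) :
    crlbAz J = (J 0 0 - J 0 1 ^ 2 / jTilde J)⁻¹ := by
  have h' : J 0 0 - J 0 1 ^ 2 / jTilde J = (J 0 0 * jTilde J - J 0 1 ^ 2) / jTilde J := by
    field_simp
  rw [crlbAz, Matrix.inv_def, det_equivFisher, h', inv_div]
  simp [equivFisher, Matrix.adjugate_fin_two, div_eq_inv_mul]

lemma crlbEl_eq_schur (h : J 0 0 ≠ 0) :
    crlbEl J = (jTilde J - J 0 1 ^ 2 / J 0 0)⁻¹ := by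
  have h' : jTilde J - J 0 1 ^ 2 / J 0 0 = (J 0 0 * jTilde J - J 0 1 ^ 2) / J 0 0 := by
    field_simp
  rw [crlbEl, Matrix.inv_def, det_equivFisher, h', inv_div]
  simp [equivFisher, Matrix.adjugate_fin_two, div_eq_inv_mul]

lemma jTilde_eq_of_smul {c : ℝ} (h : jAlphaAlpha J = c • (1 : Matrix (Fin 2) (Fin 2) ℝ)) :
    jTilde J = J 1 1 - (jPhiAlpha J 0 ^ 2 + jPhiAlpha J 1 ^ 2) / c := by
  have hinv : (c • (1 : Matrix (Fin 2) (Fin 2) ℝ))⁻¹ = c⁻¹ • 1 := by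
    -- At `c = 0` the matrix inverse and the scalar inverse both default to zero.
    rcases eq_or_ne c 0 with rfl | hc
    · simp
    · exact Matrix.inv_eq_right_inv (by simp [smul_smul, hc])
  rw [jTilde, h, hinv]
  simp [Matrix.smul_mulVec, dotProduct, Fin.sum_univ_two]
  ring

/-- Once the isotropic part of the transmit covariance is nonzero, invertibility of the equivalent
Fisher information makes every denominator nonzero. -/
theorem denominators_ne_zero {Nth Ntv Nrh Nrv L : ℕ} {Ω : Type*} [MeasurableSpace Ω]
    {P : Measure Ω} {X : Ω → Matrix (Fin Nth × Fin Ntv) (Fin L) ℂ} (hL : 0 < L)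
    (hX : ∀ i j, Integrable (fun ω => (X ω * (X ω)ᴴ) i j) P) {σ2 : ℝ} (hσ2 : 0 < σ2)
    (θ φ θ' φ' : ℝ) (α : ℂ) {c ρ : ℝ} (hρ : 0 ≤ ρ) (hc : 0 < c)
    (hcov : transmitCov P X = (c : ℂ) • 1 + (ρ : ℂ) •
      Matrix.vecMulVec (steer Nth Ntv θ' φ') (star (steer Nth Ntv θ' φ')))
    (hJ : IsUnit (equivFisher (fisher Nrh Nrv P X σ2 θ φ α))) :
    IsUnit (jAlphaAlpha (fisher Nrh Nrv P X σ2 θ φ α)) ∧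
      jTilde (fisher Nrh Nrv P X σ2 θ φ α) ≠ 0 ∧ fisher Nrh Nrv P X σ2 θ φ α 0 0 ≠ 0 := by
  obtain ⟨h00, h11, h01, -, hαα, hφα⟩ :=
    fisher_entries (Nrh := Nrh) (Nrv := Nrv) hL hX σ2 θ φ θ' φ' α c ρ hcov
  set J := fisher Nrh Nrv P X σ2 θ φ α
  set v := steer Nth Ntv θ' φ'
  set a := steer Nth Ntv θ φ
  set aθ := steerDerivAz Nth Ntv θ φ
  set aφ := steerDerivEl Nth Ntv θ φ
  set bθ := steerDerivAz Nrh Nrv θ φ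
  set bφ := steerDerivEl Nrh Nrv θ φ
  rw [isUnit_equivFisher_iff] at hJ
  -- Source of every contradiction below: with no coupling, the determinant is the product of the
  -- diagonal entries.
  have hJ01 : (J 0 1 : ℂ) = 0 → J 0 0 ≠ 0 ∧ jTilde J ≠ 0 := fun h => by
    rw [Complex.ofReal_eq_zero] at h
    rw [h] at hJ
    refine ⟨fun h0 => hJ (by rw [h0]; ring), fun h0 => hJ (by rw [h0]; ring)⟩
  have hκ : 0 < 2 * (L : ℝ) / σ2 := by positivity
  have hα : 0 < ‖α‖ ^ 2 := by
    rcases eq_or_ne α 0 with rfl | h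
    · exact absurd (by rw [h00]; simp) (hJ01 (by rw [h01]; simp)).1
    · positivity
  have hNt0 : Nth * Ntv ≠ 0 := fun h => by
    have : IsEmpty (Fin Nth × Fin Ntv) := by
      rw [← Fintype.card_eq_zero_iff]; simpa using h
    have hNt : (Nth : ℝ) * Ntv = 0 := by exact_mod_cast h
    have hz : ∀ x y : Fin Nth × Fin Ntv → ℂ, herm x y = 0 := fun x y => by simp [herm]
    exact (hJ01 (by rw [h01, hNt]; simp [hz])).1 (by rw [h00, hNt]; simp [hz, normSqVec])
  have hNr0 : Nrh * Nrv ≠ 0 := fun h => by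
    have : IsEmpty (Fin Nrh × Fin Nrv) := by
      rw [← Fintype.card_eq_zero_iff]; simpa using h
    have hNr : (Nrh : ℝ) * Nrv = 0 := by exact_mod_cast h
    have hz : ∀ x y : Fin Nrh × Fin Nrv → ℂ, herm x y = 0 := fun x y => by simp [herm]
    exact (hJ01 (by rw [h01, hNr]; simp [hz])).1 (by rw [h00, hNr]; simp [normSqVec])
  have hNt : (0 : ℝ) < (Nth : ℝ) * Ntv := by exact_mod_cast Nat.pos_of_ne_zero hNt0
  have hNr : (0 : ℝ) < (Nrh : ℝ) * Nrv := by exact_mod_cast Nat.pos_of_ne_zero hNr0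
  set Nt : ℝ := (Nth : ℝ) * Ntv
  set Nr : ℝ := (Nrh : ℝ) * Nrv
  set κ : ℝ := 2 * (L : ℝ) / σ2
  have hdα : 0 < κ * (c * Nt * Nr + ρ * Nr * ‖herm v a‖ ^ 2) := by positivity
  have hnorm : ∀ x y : ℝ, 0 ≤ x → 0 ≤ y → c * (Nr * x + Nt * y) ≤ 0 → x = 0 ∧ y = 0 := by
    intro x y hx hy h
    have h1 : Nr * x + Nt * y ≤ 0 := by
      by_contra! h2
      exact absurd h (not_le.2 (mul_pos hc h2))
    have h2 := mul_nonneg hNr.le hx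
    have h3 := mul_nonneg hNt.le hy
    exact ⟨(mul_eq_zero.1 (by linarith : Nr * x = 0)).resolve_left hNr.ne',
      (mul_eq_zero.1 (by linarith : Nt * y = 0)).resolve_left hNt.ne'⟩
  refine ⟨?_, fun h => ?_, fun h => ?_⟩
  · rw [hαα, Matrix.isUnit_iff_isUnit_det, Matrix.det_smul]
    simpa using hdα.ne'
  · rw [jTilde_eq_of_smul hαα, h11] at h
    have hj : jPhiAlpha J 0 ^ 2 + jPhiAlpha J 1 ^ 2 =
        (κ * ρ * Nr) ^ 2 * (‖α‖ ^ 2 * (‖herm v a‖ ^ 2 * ‖herm v aφ‖ ^ 2)) := by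
      have hz : ∀ z : ℂ, z.re ^ 2 + (z * Complex.I).re ^ 2 = ‖z‖ ^ 2 := fun z => by
        rw [← Complex.normSq_eq_norm_sq, Complex.normSq_apply]; simp; ring
      have hz' := hz (star α * (herm a v * herm v aφ))
      rw [norm_mul, norm_mul, norm_star, ← star_herm v a, norm_star, mul_pow, mul_pow] at hz'
      simp only [hφα, Matrix.cons_val_zero, Matrix.cons_val_one, mul_one,
        Matrix.cons_val_fin_one]
      rw [← hz', star_herm]
      ring
    rw [hj] at h
    set p := ‖herm v a‖ ^ 2 with hp
    set q := ‖herm v aφ‖ ^ 2 with hq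
    have hp0 : 0 ≤ p := by positivity
    have hq0 : 0 ≤ q := by positivity
    -- The loss from eliminating `α` is bounded by one `ρ` term of `J 1 1`; after clearing the
    -- denominator the slack is exactly the contribution of `c * Nt * Nr`.
    have hle : (κ * ρ * Nr) ^ 2 * (‖α‖ ^ 2 * (p * q)) / (κ * (c * Nt * Nr + ρ * Nr * p)) ≤
        κ * ‖α‖ ^ 2 * (ρ * (Nr * q)) := by
      rw [div_le_iff₀ hdα]
      have : 0 ≤ κ ^ 2 * ‖α‖ ^ 2 * ρ * Nr ^ 2 * q * (c * Nt) := by positivity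
      linear_combination this
    have hb0 := normSqVec_nonneg bφ
    have hpb : 0 ≤ κ * ‖α‖ ^ 2 * (ρ * (p * normSqVec bφ)) := by positivity
    have hsum : κ * ‖α‖ ^ 2 * (c * (Nr * normSqVec aφ + Nt * normSqVec bφ)) ≤ 0 := by
      linear_combination h + hle + hpb
    obtain ⟨ha, hb⟩ := hnorm _ _ (normSqVec_nonneg aφ) hb0
      (by by_contra! h2; exact absurd hsum (not_le.2 (by positivity)))
    refine (hJ01 ?_).2 (by rw [jTilde_eq_of_smul hαα, h11, hj]; exact h)
    rw [h01, eq_zero_of_normSqVec_eq_zero ha, eq_zero_of_normSqVec_eq_zero hb]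
    simp [herm]
  · have h' := h
    rw [h00] at h
    have hb0 := normSqVec_nonneg bθ
    have hsum := (mul_eq_zero.1 h).resolve_left (by positivity)
    obtain ⟨ha, hb⟩ := hnorm _ _ (normSqVec_nonneg aθ) hb0 (by
      have : 0 ≤ ρ * (‖herm v a‖ ^ 2 * normSqVec bθ + Nr * ‖herm v aθ‖ ^ 2) := by positivity
      linarith)
    refine (hJ01 ?_).1 h'
    rw [h01, eq_zero_of_normSqVec_eq_zero ha, eq_zero_of_normSqVec_eq_zero hb]
    simp [herm]

end Bounds

/-! ### Complex Gaussian vectors -/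

section Gaussian

open scoped ENNReal

/-- The real-linear map `(x, y) ↦ x + y j`. -/
noncomputable def ofRealPair : ℝ × ℝ →L[ℝ] ℂ :=
  Complex.ofRealCLM.comp (ContinuousLinearMap.fst ℝ ℝ ℝ) +
    (Complex.ofRealCLM.comp (ContinuousLinearMap.snd ℝ ℝ ℝ)).smulRight Complex.I

lemma complexGaussian_eq_map (v : ℝ≥0) : complexGaussian v =
    ((gaussianReal 0 (v / 2)).prod (gaussianReal 0 (v / 2))).map ofRealPair := by
  unfold complexGaussian
  congr 1

lemma measurable_ofReal_add_mul_I :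
    Measurable (fun p : ℝ × ℝ => (p.1 : ℂ) + (p.2 : ℂ) * Complex.I) := by fun_prop

instance isProbabilityMeasure_complexGaussian (v : ℝ≥0) :
    IsProbabilityMeasure (complexGaussian v) :=
  Measure.isProbabilityMeasure_map measurable_ofReal_add_mul_I.aemeasurable

instance isProbabilityMeasure_complexGaussianVec (ι : Type*) [Fintype ι] (v : ℝ≥0) :
    IsProbabilityMeasure (complexGaussianVec ι v) := by
  unfold complexGaussianVec
  infer_instance

lemma charFunDual_gaussianReal_zero (v : ℝ≥0) (ℓ : StrongDual ℝ ℝ) :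
    charFunDual (gaussianReal 0 v) ℓ = Complex.exp (-(v * ℓ 1 ^ 2 / 2 : ℝ)) := by
  have hℓ : ℓ = ℓ 1 • ContinuousLinearMap.id ℝ ℝ := by
    ext; simp
  rw [hℓ, ← charFun_map_eq_charFunDual_smul]
  simp [charFun_gaussianReal, Measure.map_id]

/-- The constant `v / 4` is half of the variance `v / 2` of each real component. -/
lemma charFunDual_complexGaussian (v : ℝ≥0) (ℓ : StrongDual ℝ ℂ) :
    charFunDual (complexGaussian v) ℓ =
      Complex.exp (-(v / 4 * (ℓ 1 ^ 2 + ℓ Complex.I ^ 2) : ℝ)) := by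
  rw [complexGaussian_eq_map, charFunDual_map, charFunDual_prod, charFunDual_gaussianReal_zero,
    charFunDual_gaussianReal_zero, ← Complex.exp_add]
  congr 1
  simp [ofRealPair]
  ring

variable {ι κ : Type*} [Fintype ι] [Fintype κ]

lemma charFunDual_complexGaussianVec [DecidableEq ι] (v : ℝ≥0) (ℓ : StrongDual ℝ (ι → ℂ)) :
    charFunDual (complexGaussianVec ι v) ℓ = Complex.exp (-(v / 4 *
      ∑ i, (ℓ (Pi.single i 1) ^ 2 + ℓ (Pi.single i Complex.I) ^ 2) : ℝ)) := by
  rw [complexGaussianVec, charFunDual_pi]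
  simp only [charFunDual_complexGaussian]
  rw [← Complex.exp_sum, Finset.mul_sum, Complex.ofReal_sum, Finset.sum_neg_distrib]
  rfl

/-- Represents real functionals by complex vectors, so that precomposing with `A` becomes applying
`Aᴴ`. -/
lemma dual_apply_eq_re (ℓ : StrongDual ℝ ℂ) (z : ℂ) :
    ℓ z = (star ((ℓ 1 : ℂ) + ℓ Complex.I * Complex.I) * z).re := by
  have hz : z = z.re • (1 : ℂ) + z.im • Complex.I := by
    simp [Complex.re_add_im]
  conv_lhs => rw [hz, map_add, map_smul, map_smul]
  simp
  ring

lemma sum_re_dotProduct_single_sq [DecidableEq ι] (d : ι → ℂ) :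
    ∑ i, ((star d ⬝ᵥ Pi.single i 1).re ^ 2 + (star d ⬝ᵥ Pi.single i Complex.I).re ^ 2) =
      normSqVec d := by
  refine Finset.sum_congr rfl fun i _ => ?_
  rw [← Complex.normSq_eq_norm_sq, Complex.normSq_apply]
  simp
  ring

/-- A matrix with orthonormal rows maps a complex Gaussian vector to a complex Gaussian vector. -/
theorem map_mulVec_complexGaussianVec [DecidableEq ι] [DecidableEq κ] (v : ℝ≥0)
    {A : Matrix κ ι ℂ} (hA : A * Aᴴ = 1) :
    (complexGaussianVec ι v).map (fun x => A *ᵥ x) = complexGaussianVec κ v := by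
  have hcont : Continuous (fun x : ι → ℂ => A *ᵥ x) := by fun_prop
  have : IsProbabilityMeasure ((complexGaussianVec ι v).map (fun x => A *ᵥ x)) :=
    Measure.isProbabilityMeasure_map hcont.measurable.aemeasurable
  let T : (ι → ℂ) →L[ℝ] (κ → ℂ) := ⟨(Matrix.mulVecLin A).restrictScalars ℝ, hcont⟩
  refine Measure.ext_of_charFunDual (funext fun ℓ => ?_)
  have hT : (complexGaussianVec ι v).map (fun x => A *ᵥ x) = (complexGaussianVec ι v).map T := rfl
  rw [hT, charFunDual_map, charFunDual_complexGaussianVec, charFunDual_complexGaussianVec]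
  set c : κ → ℂ := fun k => (ℓ (Pi.single k 1) : ℂ) + ℓ (Pi.single k Complex.I) * Complex.I
  have hℓ : ∀ x : κ → ℂ, ℓ x = (star c ⬝ᵥ x).re := fun x => by
    conv_lhs => rw [← ContinuousLinearMap.sum_comp_single (R := ℝ) (L := ℓ) (v := x)]
    simp only [dotProduct, Complex.re_sum, Pi.star_apply]
    exact Finset.sum_congr rfl fun k _ =>
      dual_apply_eq_re (ℓ.comp (ContinuousLinearMap.single ℝ (fun _ => ℂ) k)) (x k)
  have hcomp : ∀ x, (ℓ.comp T) x = (star (Aᴴ *ᵥ c) ⬝ᵥ x).re := fun x => by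
    rw [Matrix.star_mulVec, Matrix.conjTranspose_conjTranspose, ← Matrix.dotProduct_mulVec]
    exact hℓ (A *ᵥ x)
  simp only [hcomp, hℓ]
  rw [sum_re_dotProduct_single_sq, sum_re_dotProduct_single_sq]
  -- The characteristic function depends only on the norm of the representing vector, and `A * Aᴴ =
  -- 1` makes `Aᴴ` an isometry.
  have hn : normSqVec (Aᴴ *ᵥ c) = normSqVec c := by
    have : herm (Aᴴ *ᵥ c) (Aᴴ *ᵥ c) = herm c c := by
      unfold herm
      rw [Matrix.star_mulVec, Matrix.conjTranspose_conjTranspose, ← Matrix.dotProduct_mulVec,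
        Matrix.mulVec_mulVec, hA, Matrix.one_mulVec]
    rw [herm_self, herm_self] at this
    exact_mod_cast this
  rw [hn]

lemma integral_exp_neg_mul_sq_gaussianReal {w : ℝ≥0} (hw : w ≠ 0) {t : ℝ} (ht : 0 ≤ t) :
    ∫ x, Real.exp (-t * x ^ 2) ∂(gaussianReal 0 w) = √(1 / (1 + 2 * t * w)) := by
  have hw' : (0 : ℝ) < w := NNReal.coe_pos.2 (pos_iff_ne_zero.2 hw)
  rw [integral_gaussianReal_eq_integral_smul hw]
  have h : ∀ x : ℝ, gaussianPDFReal 0 w x • Real.exp (-t * x ^ 2) =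
      (√(2 * Real.pi * w))⁻¹ * Real.exp (-(t + 1 / (2 * w)) * x ^ 2) := fun x => by
    rw [gaussianPDFReal, smul_eq_mul, mul_assoc, ← Real.exp_add]
    congr 2
    field_simp
    ring
  simp only [h]
  rw [integral_const_mul, integral_gaussian, ← Real.sqrt_inv, ← Real.sqrt_mul (by positivity)]
  congr 1
  have := Real.pi_pos
  field_simp
  ring

/-- Real and imaginary parts are independent with variance `v / 2`, so two equal square roots
multiply to a rational function. -/
lemma integral_exp_neg_mul_norm_sq_complexGaussian {v : ℝ≥0} (hv : v ≠ 0) {t : ℝ} (ht : 0 ≤ t) :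
    ∫ z, Real.exp (-t * ‖z‖ ^ 2) ∂(complexGaussian v) = (1 + t * v)⁻¹ := by
  have hexp : ∀ p : ℝ × ℝ, Real.exp (-t * ‖(p.1 : ℂ) + (p.2 : ℂ) * Complex.I‖ ^ 2) =
      Real.exp (-t * p.1 ^ 2) * Real.exp (-t * p.2 ^ 2) := fun p => by
    rw [← Real.exp_add, ← Complex.normSq_eq_norm_sq, Complex.normSq_add_mul_I]
    congr 1
    ring
  rw [complexGaussian, integral_map measurable_ofReal_add_mul_I.aemeasurable (by fun_prop)]
  simp only [hexp]
  rw [integral_prod_mul (fun x : ℝ => Real.exp (-t * x ^ 2)) (fun x : ℝ => Real.exp (-t * x ^ 2)),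
    integral_exp_neg_mul_sq_gaussianReal (by simpa using hv) ht, Real.mul_self_sqrt (by positivity)]
  push_cast
  rw [one_div]
  congr 2
  ring

lemma integral_exp_neg_mul_normSqVec {v : ℝ≥0} (hv : v ≠ 0) {t : ℝ} (ht : 0 ≤ t) :
    ∫ x, Real.exp (-t * normSqVec x) ∂(complexGaussianVec ι v) =
      ((1 + t * v) ^ Fintype.card ι)⁻¹ := by
  have h : ∀ x : ι → ℂ, Real.exp (-t * normSqVec x) = ∏ i, Real.exp (-t * ‖x i‖ ^ 2) := fun x => by
    rw [normSqVec, Finset.mul_sum, Real.exp_sum]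
  simp only [h]
  rw [complexGaussianVec,
    integral_fintype_prod_eq_prod (fun _ : ι => fun z : ℂ => Real.exp (-t * ‖z‖ ^ 2))]
  simp only [integral_exp_neg_mul_norm_sq_complexGaussian hv ht]
  simp

@[fun_prop]
lemma measurable_normSqVec : Measurable (normSqVec : (ι → ℂ) → ℝ) := by
  unfold normSqVec
  fun_prop

/-- Stated in `[0, ∞]` so that `q = 0` is included: both sides are then infinite. -/
lemma lintegral_exp_neg_mul_Ioi {q : ℝ} (hq : 0 ≤ q) :
    ∫⁻ t in Set.Ioi (0 : ℝ), ENNReal.ofReal (Real.exp (-t * q)) = (ENNReal.ofReal q)⁻¹ := by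
  rcases hq.eq_or_lt with rfl | hq
  · simp
  · have h1 : ∀ t : ℝ, -t * q = -q * t := fun t => by ring
    simp only [h1]
    rw [← ofReal_integral_eq_lintegral_ofReal (integrableOn_exp_mul_Ioi (by linarith) 0)
      (ae_of_all _ fun _ => (Real.exp_pos _).le), integral_exp_mul_Ioi (by linarith) 0,
      ← ENNReal.ofReal_inv_of_pos hq]
    simp

lemma lintegral_inv_pow_Ioi {v : ℝ} (hv : 0 < v) {m : ℕ} (hm : 2 ≤ m) :
    ∫⁻ t in Set.Ioi (0 : ℝ), ENNReal.ofReal (((1 + t * v) ^ m)⁻¹) =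
      ENNReal.ofReal (1 / (v * ((m : ℝ) - 1))) := by
  obtain ⟨n, rfl⟩ : ∃ n, m = n + 2 := ⟨m - 2, by omega⟩
  -- An antiderivative vanishing at infinity; with `m = n + 2` its exponent `n + 1` is `m - 1`.
  set g : ℝ → ℝ := fun t => -(v * ((n : ℝ) + 1))⁻¹ * ((1 + t * v) ^ (n + 1))⁻¹ with hg
  have hderiv : ∀ t ∈ Set.Ici (0 : ℝ), HasDerivAt g (((1 + t * v) ^ (n + 2))⁻¹) t := fun t ht => by
    have ht' : 0 < 1 + t * v := by
      have : 0 ≤ t * v := mul_nonneg ht hv.le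
      linarith
    have h := (((((hasDerivAt_id t).mul_const v).const_add 1).pow (n + 1)).inv
      (pow_pos ht' _).ne').const_mul (-(v * ((n : ℝ) + 1))⁻¹)
    refine h.congr_deriv ?_
    have h0 : 1 + v * t ≠ 0 := by rw [mul_comm]; exact ht'.ne'
    simp
    field_simp
    ring
  have hlim : Filter.Tendsto g Filter.atTop (nhds 0) := by
    have h1 : Filter.Tendsto (fun t : ℝ => 1 + t * v) Filter.atTop Filter.atTop :=
      Filter.tendsto_atTop_add_const_left _ _ (Filter.tendsto_id.atTop_mul_const hv)
    have h2 := (tendsto_inv_atTop_zero.comp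
      ((Filter.tendsto_pow_atTop (Nat.succ_ne_zero n)).comp h1)).const_mul
        (-(v * ((n : ℝ) + 1))⁻¹)
    simpa [hg] using h2
  have hpos : ∀ t ∈ Set.Ioi (0 : ℝ), 0 ≤ ((1 + t * v) ^ (n + 2))⁻¹ := fun t ht => by
    have : 0 ≤ t * v := mul_nonneg (le_of_lt ht) hv.le
    positivity
  rw [← ofReal_integral_eq_lintegral_ofReal (integrableOn_Ioi_deriv_of_nonneg' hderiv hpos hlim)
    ((ae_restrict_iff' measurableSet_Ioi).2 (ae_of_all _ hpos)),
    integral_Ioi_of_hasDerivAt_of_tendsto' hderiv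
      (integrableOn_Ioi_deriv_of_nonneg' hderiv hpos hlim) hlim]
  congr 1
  rw [hg, show ((n + 2 : ℕ) : ℝ) - 1 = n + 1 by push_cast; ring]
  simp

/-- The inverse moment `E ‖x‖⁻²` of a complex Gaussian vector of dimension at least two. -/
theorem lintegral_inv_normSqVec {v : ℝ≥0} (hv : v ≠ 0) (hm : 2 ≤ Fintype.card ι) :
    ∫⁻ x, (ENNReal.ofReal (normSqVec x))⁻¹ ∂(complexGaussianVec ι v) =
      ENNReal.ofReal (1 / (v * ((Fintype.card ι : ℝ) - 1))) := by
  have hv' : (0 : ℝ) < v := NNReal.coe_pos.2 (pos_iff_ne_zero.2 hv)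
  simp only [← lintegral_exp_neg_mul_Ioi (normSqVec_nonneg _)]
  -- Tonelli: the inner integral becomes the Laplace transform of the squared norm.
  rw [lintegral_lintegral_swap (by fun_prop), ← lintegral_inv_pow_Ioi hv' hm]
  refine setLIntegral_congr_fun measurableSet_Ioi fun t ht => ?_
  have ht : 0 ≤ t := le_of_lt ht
  rw [← integral_exp_neg_mul_normSqVec (ι := ι) hv ht]
  refine (ofReal_integral_eq_lintegral_ofReal ?_ (ae_of_all _ fun _ => (Real.exp_pos _).le)).symm
  refine Integrable.of_bound (C := 1) (by fun_prop) (ae_of_all _ fun x => ?_)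
  rw [Real.norm_of_nonneg (Real.exp_pos _).le, Real.exp_le_one_iff]
  have := mul_nonneg ht (normSqVec_nonneg x)
  linarith

lemma lintegral_normSqVec (v : ℝ≥0) :
    ∫⁻ x, ENNReal.ofReal (normSqVec x) ∂(complexGaussianVec ι v) =
      ENNReal.ofReal (Fintype.card ι * v) := by
  have hg : ∫⁻ x : ℝ, ENNReal.ofReal (x ^ 2) ∂(gaussianReal 0 (v / 2)) =
      ENNReal.ofReal (v / 2) := by
    have h1 := variance_id_gaussianReal (μ := 0) (v := v / 2)
    rw [variance_of_integral_eq_zero aemeasurable_id (by simp)] at h1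
    have h2 : Integrable (fun x : ℝ => x ^ 2) (gaussianReal 0 (v / 2)) :=
      (memLp_id_gaussianReal 2).integrable_sq
    rw [← ofReal_integral_eq_lintegral_ofReal h2
      (ae_of_all _ fun _ => sq_nonneg _)]
    exact congrArg ENNReal.ofReal (by simpa using h1)
  have hc : ∫⁻ z : ℂ, ENNReal.ofReal (‖z‖ ^ 2) ∂(complexGaussian v) = ENNReal.ofReal v := by
    rw [complexGaussian, lintegral_map (by fun_prop) measurable_ofReal_add_mul_I]
    have : ∀ p : ℝ × ℝ, ENNReal.ofReal (‖(p.1 : ℂ) + (p.2 : ℂ) * Complex.I‖ ^ 2) =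
        ENNReal.ofReal (p.1 ^ 2) + ENNReal.ofReal (p.2 ^ 2) := fun p => by
      rw [← ENNReal.ofReal_add (sq_nonneg _) (sq_nonneg _), ← Complex.normSq_eq_norm_sq,
        Complex.normSq_add_mul_I]
    simp only [this]
    rw [lintegral_add_left (by fun_prop),
      lintegral_prod _ (by fun_prop), lintegral_prod _ (by fun_prop)]
    simp only [lintegral_const, measure_univ, mul_one, hg]
    rw [← ENNReal.ofReal_add (by positivity) (by positivity), add_halves]
  have hi : ∀ i : ι, ∫⁻ x : ι → ℂ, ENNReal.ofReal (‖x i‖ ^ 2) ∂(complexGaussianVec ι v) =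
      ENNReal.ofReal v := fun i => by
    rw [← hc]
    exact (measurePreserving_eval (fun _ : ι => complexGaussian v) i).lintegral_comp
      (f := fun z : ℂ => ENNReal.ofReal (‖z‖ ^ 2)) (by fun_prop)
  simp only [normSqVec, ENNReal.ofReal_sum_of_nonneg fun _ _ => sq_nonneg _]
  rw [lintegral_finsetSum _ (by fun_prop)]
  simp only [hi]
  simp [ENNReal.ofReal_mul]

end Gaussian

/-! ### Isotropic random vectors -/

section Isotropic

variable {ι : Type*} [Fintype ι] [DecidableEq ι]

/-- First and second moments of a law that is invariant under unitary matrices. -/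
theorem moments_of_unitary_invariant {ν : Measure (ι → ℂ)} [IsProbabilityMeasure ν]
    (hinv : ∀ A : Matrix ι ι ℂ, A * Aᴴ = 1 → ν.map (fun x => A *ᵥ x) = ν) {s : ℝ} (hs0 : 0 ≤ s)
    (hs : ∫⁻ x, ENNReal.ofReal (normSqVec x) ∂ν = ENNReal.ofReal s) :
    (∀ i, MemLp (fun x : ι → ℂ => x i) 2 ν) ∧ (∀ i, ∫ x, x i ∂ν = 0) ∧
      ∀ i j, ∫ x, x i * star (x j) ∂ν = if i = j then ((s / Fintype.card ι : ℝ) : ℂ) else 0 := by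
  have hint : Integrable (normSqVec : (ι → ℂ) → ℝ) ν := by
    refine ⟨by fun_prop, ?_⟩
    rw [hasFiniteIntegral_iff_ofReal (ae_of_all _ normSqVec_nonneg), hs]
    exact ENNReal.ofReal_lt_top
  have hsq : ∀ i, Integrable (fun x : ι → ℂ => ‖x i‖ ^ 2) ν := fun i =>
    hint.mono' (Measurable.aestronglyMeasurable (by fun_prop)) (ae_of_all _ fun x => by
      rw [Real.norm_of_nonneg (by positivity)]
      exact Finset.single_le_sum (f := fun i => ‖x i‖ ^ 2) (fun i _ => by positivity)
        (Finset.mem_univ i))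
  have hchange : ∀ A : Matrix ι ι ℂ, A * Aᴴ = 1 → ∀ f : (ι → ℂ) → ℂ, Measurable f →
      ∫ x, f x ∂ν = ∫ x, f (A *ᵥ x) ∂ν := fun A hA f hf => by
    conv_lhs => rw [← hinv A hA]
    exact integral_map (by fun_prop) hf.aestronglyMeasurable
  -- Flipping the sign of one coordinate shows that means and off-diagonal moments equal their own
  -- negatives.
  let D : ι → Matrix ι ι ℂ := fun i => Matrix.diagonal (fun j => if j = i then -1 else 1)
  have hD : ∀ i, D i * (D i)ᴴ = 1 := fun i => by
    rw [Matrix.diagonal_conjTranspose, Matrix.diagonal_mul_diagonal, ← Matrix.diagonal_one]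
    congr 1
    funext j
    by_cases h : j = i <;> simp [h]
  have hDx : ∀ i x, (D i *ᵥ x) i = -x i := fun i x => by simp [D, Matrix.mulVec_diagonal]
  have hDx' : ∀ i j x, j ≠ i → (D i *ᵥ x) j = x j := fun i j x h => by
    simp [D, Matrix.mulVec_diagonal, h]
  -- Swapping two coordinates equates the diagonal moments, so each is the total `s` over the
  -- dimension.
  let W : ι → ι → Matrix ι ι ℂ := fun i j => (1 : Matrix ι ι ℂ).submatrix (Equiv.swap i j) id
  have hW : ∀ i j, W i j * (W i j)ᴴ = 1 := fun i j => by
    ext k l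
    simp [W, Matrix.mul_apply, Matrix.one_apply]
  have hWx : ∀ i j x, (W i j *ᵥ x) i = x j := fun i j x => by
    simp [W, Matrix.mulVec, dotProduct, Matrix.one_apply]
  refine ⟨fun i => (memLp_two_iff_integrable_sq_norm
    (measurable_pi_apply i).aestronglyMeasurable).2 (hsq i), fun i => ?_,
    fun i j => ?_⟩
  · have h := hchange (D i) (hD i) (fun x => x i) (by fun_prop)
    simp only [hDx, integral_neg] at h
    exact self_eq_neg.1 h
  · split_ifs with hij
    · subst hij
      have hnorm : ∀ (x : ι → ℂ) i, x i * star (x i) = ((‖x i‖ ^ 2 : ℝ) : ℂ) := fun x i => by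
        rw [Complex.star_def, Complex.mul_conj', Complex.ofReal_pow]
      simp only [hnorm]
      rw [integral_complex_ofReal]
      congr 1
      have hall : ∀ j, ∫ x : ι → ℂ, ‖x j‖ ^ 2 ∂ν = ∫ x : ι → ℂ, ‖x i‖ ^ 2 ∂ν := fun j => by
        have h := hchange (W i j) (hW i j) (fun x => ((‖x i‖ ^ 2 : ℝ) : ℂ)) (by fun_prop)
        simp only [hWx, integral_complex_ofReal] at h
        exact_mod_cast h.symm
      have hsum : ∫ x, normSqVec x ∂ν = s := by
        have h := ofReal_integral_eq_lintegral_ofReal hint (ae_of_all _ normSqVec_nonneg)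
        rw [hs] at h
        exact (ENNReal.ofReal_eq_ofReal_iff (integral_nonneg normSqVec_nonneg) hs0).1 h
      simp only [normSqVec] at hsum
      rw [integral_finsetSum _ fun i _ => hsq i, Finset.sum_congr rfl fun j _ => hall j,
        Finset.sum_const, Finset.card_univ, nsmul_eq_mul] at hsum
      have hcard : (Fintype.card ι : ℝ) ≠ 0 := by
        exact_mod_cast (Fintype.card_pos_iff.2 ⟨i⟩).ne'
      rw [← hsum]
      field_simp
    · have h := hchange (D i) (hD i) (fun x => x i * star (x j)) (by fun_prop)
      simp only [hDx, hDx' i j _ (Ne.symm hij), neg_mul, integral_neg] at h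
      exact self_eq_neg.1 h

end Isotropic

/-! ### The zero-forcing precoder -/

section ZeroForcing

variable {ι : Type*} [Fintype ι] {K : ℕ}

/-- The matrix with the given columns. -/
def ofCols (M : Fin K → ι → ℂ) : Matrix ι (Fin K) ℂ := fun i k => M k i

/-- The `k`-th zero-forcing beamformer for the given channels. -/
noncomputable def zfCol (k : Fin K) (M : Fin K → ι → ℂ) (i : ι) : ℂ :=
  commPrecoder .ZF (ofCols M) i k

lemma isUnit_det_gram_iff (M : Fin K → ι → ℂ) :
    IsUnit ((ofCols M)ᴴ * ofCols M).det ↔ LinearIndependent ℂ M := by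
  have hcol : (ofCols M).col = M := rfl
  rw [← hcol, ← Matrix.mulVec_injective_iff]
  constructor
  · intro h x y hxy
    have h' : ((ofCols M)ᴴ * ofCols M) *ᵥ x = ((ofCols M)ᴴ * ofCols M) *ᵥ y := by
      rw [← Matrix.mulVec_mulVec, ← Matrix.mulVec_mulVec, hxy]
    exact Matrix.mulVec_injective_of_isUnit ((Matrix.isUnit_iff_isUnit_det _).2 h) h'
  · intro h
    rw [← Matrix.isUnit_iff_isUnit_det]
    open scoped ComplexOrder in
    exact (Matrix.PosDef.conjTranspose_mul_self _ h).isUnit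

/-- A matrix whose rows form an orthonormal basis of the orthogonal complement of the span of
finitely many vectors. -/
lemma exists_orthogonal_complement_matrix {τ : Type*} [Fintype τ] (u : τ → ι → ℂ) :
    ∃ (m : ℕ) (A : Matrix (Fin m) ι ℂ), A * Aᴴ = 1 ∧ (∀ j, A *ᵥ u j = 0) ∧
      (∀ y, (∀ j, herm (u j) y = 0) → Aᴴ *ᵥ (A *ᵥ y) = y) ∧
      Fintype.card ι ≤ m + Fintype.card τ ∧
      (LinearIndependent ℂ u → Fintype.card ι = m + Fintype.card τ) := by
  let e : (ι → ℂ) ≃ₗ[ℂ] EuclideanSpace ℂ ι := (WithLp.linearEquiv 2 ℂ (ι → ℂ)).symm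
  let V : Submodule ℂ (EuclideanSpace ℂ ι) := Submodule.span ℂ (Set.range (e ∘ u))
  let b := stdOrthonormalBasis ℂ Vᗮ
  have hfin : Module.finrank ℂ V + Module.finrank ℂ Vᗮ = Fintype.card ι := by
    rw [V.finrank_add_finrank_orthogonal, finrank_euclideanSpace]
  have hA : ∀ (j : Fin (Module.finrank ℂ Vᗮ)) (y : ι → ℂ),
      ((Matrix.of fun j i => star ((b j : EuclideanSpace ℂ ι) i)) *ᵥ y) j =
        inner ℂ (b j : EuclideanSpace ℂ ι) (e y) := fun j y => by
    rw [EuclideanSpace.inner_eq_star_dotProduct, dotProduct_comm]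
    rfl
  refine ⟨Module.finrank ℂ Vᗮ, Matrix.of fun j i => star ((b j : EuclideanSpace ℂ ι) i),
    ?_, fun j => ?_, fun y hy => ?_, ?_, fun hu => ?_⟩
  · ext j l
    have h := orthonormal_iff_ite.1 b.orthonormal j l
    rw [Submodule.coe_inner, EuclideanSpace.inner_eq_star_dotProduct] at h
    rw [Matrix.one_apply, ← h, Matrix.mul_apply, dotProduct_comm]
    simp [dotProduct]
  · funext l
    rw [hA]
    exact Submodule.inner_left_of_mem_orthogonal
      (Submodule.subset_span (Set.mem_range_self j)) (b l).2
  · have hyV : e y ∈ Vᗮ := by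
      rw [Submodule.mem_orthogonal]
      intro w hw
      induction hw using Submodule.span_induction with
      | mem x hx =>
        obtain ⟨j, rfl⟩ := hx
        rw [EuclideanSpace.inner_eq_star_dotProduct, dotProduct_comm]
        exact hy j
      | zero => simp
      | add x z _ _ hx hz => rw [inner_add_left, hx, hz, add_zero]
      | smul c x _ hx => rw [inner_smul_left, hx, mul_zero]
    -- `Aᴴ A y = y` is the expansion of `y` in the orthonormal basis `b`.
    have h := congrArg (fun z : Vᗮ => (z : EuclideanSpace ℂ ι)) (b.sum_repr ⟨e y, hyV⟩)
    simp only [Submodule.coe_sum, Submodule.coe_smul, b.repr_apply_apply, Submodule.coe_inner] at h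
    have h' : e.symm (∑ j, inner ℂ (b j : EuclideanSpace ℂ ι) (e y) •
        (b j : EuclideanSpace ℂ ι)) = y := by rw [h, e.symm_apply_apply]
    conv_rhs => rw [← h']
    funext i
    rw [map_sum, Finset.sum_apply]
    change ∑ j : Fin (Module.finrank ℂ Vᗮ), _ * _ = _
    refine Finset.sum_congr rfl fun j _ => ?_
    rw [hA, Matrix.conjTranspose_apply, Matrix.of_apply, star_star, mul_comm]
    rfl
  · have : Module.finrank ℂ V ≤ Fintype.card τ := finrank_range_le_card _
    omega
  · have hV : Module.finrank ℂ V = Fintype.card τ :=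
      finrank_span_eq_card (hu.map' e.toLinearMap e.ker)
    omega

/-- The squared norm of the zero-forcing beamformer is the inverse of the squared distance of its
channel to the span of the other channels. -/
lemma normSqVec_zfCol {n m : ℕ} (k : Fin (n + 1)) {M : Fin (n + 1) → ι → ℂ}
    (hM : LinearIndependent ℂ M) {A : Matrix (Fin m) ι ℂ}
    (hA0 : ∀ j, A *ᵥ M (k.succAbove j) = 0)
    (hA1 : ∀ y, (∀ j, herm (M (k.succAbove j)) y = 0) → Aᴴ *ᵥ (A *ᵥ y) = y) :
    normSqVec (zfCol k M) * normSqVec (A *ᵥ M k) = 1 := by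
  have hdet := (isUnit_det_gram_iff M).2 hM
  set G := (ofCols M)ᴴ * ofCols M with hG
  set w := zfCol k M with hw
  have hwcol : ∀ i, w i = (ofCols M * G⁻¹) i k := fun i => rfl
  -- The beamformers form the dual basis of the channels: `Hᴴ (H G⁻¹) = 1`.
  have hdual : ∀ j, herm (M j) w = if j = k then 1 else 0 := fun j => by
    have h : ((ofCols M)ᴴ * (ofCols M * G⁻¹)) j k =
        (1 : Matrix (Fin (n + 1)) (Fin (n + 1)) ℂ) j k := by
      rw [← Matrix.mul_assoc, ← hG, Matrix.mul_nonsing_inv _ hdet]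
    rw [Matrix.one_apply, Matrix.mul_apply] at h
    rw [← h]
    rfl
  have hproj : Aᴴ *ᵥ (A *ᵥ w) = w := hA1 w fun j => by
    rw [hdual, if_neg (k.succAbove_ne j)]
  set c := G⁻¹ k k
  -- `w` is a combination of the channels, and `A` annihilates all of them except `M k`.
  have hAw : A *ᵥ w = c • (A *ᵥ M k) := by
    have hwsum : w = ∑ j, G⁻¹ j k • M j := by
      funext i
      rw [hwcol, Matrix.mul_apply, Finset.sum_apply]
      exact Finset.sum_congr rfl fun j _ => mul_comm _ _
    rw [hwsum, Matrix.mulVec_sum, Fin.sum_univ_succAbove _ k]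
    simp only [Matrix.mulVec_smul, hA0, smul_zero, Finset.sum_const_zero, add_zero]
    rfl
  have hadj : ∀ x y : ι → ℂ, herm x (Aᴴ *ᵥ (A *ᵥ y)) = herm (A *ᵥ x) (A *ᵥ y) := fun x y => by
    rw [herm, herm, Matrix.star_mulVec, ← Matrix.dotProduct_mulVec]
  set p := normSqVec (A *ᵥ M k) with hp
  have hcp : c * (p : ℂ) = 1 := by
    have h := hdual k
    rw [if_pos rfl, ← hproj, hadj, hAw] at h
    rw [hp, ← herm_self, ← h]
    simp [herm]
  have hw2 : (normSqVec w : ℂ) = star c * c * p := by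
    have h : herm w w = herm (A *ᵥ w) (A *ᵥ w) := by
      conv_lhs => rw [← hproj]
      rw [hproj, ← hadj, hproj]
    rw [← herm_self, h, hAw, hp, ← herm_self]
    simp [herm]
    ring
  have hcp' : star c * (p : ℂ) = 1 := by
    have h := congrArg star hcp
    rw [star_mul, star_one, mul_comm, Complex.star_def, Complex.conj_ofReal] at h
    exact h
  have : (normSqVec w : ℂ) * p = 1 := by
    rw [hw2]
    linear_combination hcp + c * p * hcp'
  exact_mod_cast this

/-- A unitary cancels in the Gram matrix; this equivariance makes the law of the beamformer
unitarily invariant. -/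
lemma zfCol_mulVec [DecidableEq ι] (k : Fin K) {A : Matrix ι ι ℂ} (hA : A * Aᴴ = 1)
    (M : Fin K → ι → ℂ) :
    zfCol k (fun j => A *ᵥ M j) = A *ᵥ zfCol k M := by
  have hcols : ofCols (fun j => A *ᵥ M j) = A * ofCols M := by
    ext i j
    rfl
  have hA' : Aᴴ * A = 1 := mul_eq_one_comm.1 hA
  funext i
  have : commPrecoder .ZF (A * ofCols M) = A * commPrecoder .ZF (ofCols M) := by
    simp only [commPrecoder]
    rw [Matrix.conjTranspose_mul, Matrix.mul_assoc (ofCols M)ᴴ, ← Matrix.mul_assoc Aᴴ, hA',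
      Matrix.one_mul, Matrix.mul_assoc]
  rw [zfCol, hcols, this]
  rfl

end ZeroForcing

/-! ### Distribution and moments of the zero-forcing beamformers. -/

section ZeroForcingLaw

lemma continuous_ofCols {ι : Type*} {K : ℕ} :
    Continuous (ofCols : (Fin K → ι → ℂ) → Matrix ι (Fin K) ℂ) :=
  continuous_matrix fun i k => by
    unfold ofCols
    fun_prop

lemma linearIndependent_insertNth {ι : Type*} {n : ℕ} (k : Fin (n + 1)) {u : Fin n → ι → ℂ}
    (hu : LinearIndependent ℂ u) {h : ι → ℂ} (hh : h ∉ Submodule.span ℂ (Set.range u)) :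
    LinearIndependent ℂ (k.insertNth h u : Fin (n + 1) → ι → ℂ) := by
  -- Reindexing moves the inserted vector to the front.
  rw [← linearIndependent_equiv k.cycleRange.symm]
  have : (k.insertNth h u : Fin (n + 1) → ι → ℂ) ∘ k.cycleRange.symm = Fin.cons h u := by
    funext j
    refine Fin.cases ?_ (fun j => ?_) j
    · simp
    · simp
  rw [this]
  exact hu.finCons hh

variable {ι : Type*} [Fintype ι]

/-- The joint law of independent channels with laws `CN(0, ξ k I)`. -/
noncomputable def channelLaw (ι : Type*) [Fintype ι] {K : ℕ} (ξ : Fin K → ℝ≥0) :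
    Measure (Fin K → ι → ℂ) :=
  Measure.pi fun k => complexGaussianVec ι (ξ k)

instance isProbabilityMeasure_channelLaw {K : ℕ} (ξ : Fin K → ℝ≥0) :
    IsProbabilityMeasure (channelLaw ι ξ) := by
  unfold channelLaw
  infer_instance

lemma continuous_gram {K : ℕ} :
    Continuous fun M : Fin K → ι → ℂ => (ofCols M)ᴴ * ofCols M :=
  continuous_ofCols.matrix_conjTranspose.matrix_mul continuous_ofCols

lemma measurableSet_linearIndependent {K : ℕ} :
    MeasurableSet {M : Fin K → ι → ℂ | LinearIndependent ℂ M} := by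
  simp only [← isUnit_det_gram_iff, isUnit_iff_ne_zero]
  exact (continuous_gram.matrix_det.measurable (measurableSet_singleton 0)).compl

@[fun_prop]
lemma measurable_zfCol {K : ℕ} (k : Fin K) :
    Measurable (zfCol k : (Fin K → ι → ℂ) → ι → ℂ) := by
  refine measurable_pi_iff.2 fun i => ?_
  -- The adjugate formula gives measurability everywhere, including at singular Gram matrices, where
  -- the inverse defaults to zero.
  have h : ∀ M : Fin K → ι → ℂ, zfCol k M i = ∑ j, ofCols M i j *
      (((ofCols M)ᴴ * ofCols M).det⁻¹ * ((ofCols M)ᴴ * ofCols M).adjugate j k) := fun M => by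
    rw [zfCol, commPrecoder, Matrix.mul_apply]
    simp [Matrix.inv_def, Ring.inverse_eq_inv']
  simp only [h]
  refine Finset.measurable_sum _ fun j _ => ?_
  exact (continuous_ofCols.matrix_elem i j).measurable.mul
    (continuous_gram.matrix_det.measurable.inv.mul
      (continuous_gram.matrix_adjugate.matrix_elem j k).measurable)

lemma lintegral_inv_normSqVec_mulVec {m : ℕ} {A : Matrix (Fin m) ι ℂ} (hA : A * Aᴴ = 1)
    {v : ℝ≥0} (hv : v ≠ 0) (hm : 2 ≤ m) :
    ∫⁻ h, (ENNReal.ofReal (normSqVec (A *ᵥ h)))⁻¹ ∂(complexGaussianVec ι v) =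
      ENNReal.ofReal (1 / (v * ((m : ℝ) - 1))) := by
  classical
  have h := lintegral_inv_normSqVec (ι := Fin m) hv (by simpa using hm)
  rw [Fintype.card_fin, ← map_mulVec_complexGaussianVec v hA,
    lintegral_map (by fun_prop) (by fun_prop)] at h
  exact h

/-- A finite inverse moment rules out norm zero on a set of positive measure. -/
lemma ae_normSqVec_mulVec_pos {m : ℕ} {A : Matrix (Fin m) ι ℂ} (hA : A * Aᴴ = 1)
    {v : ℝ≥0} (hv : v ≠ 0) (hm : 2 ≤ m) :
    ∀ᵐ h ∂(complexGaussianVec ι v), 0 < normSqVec (A *ᵥ h) := by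
  have hfin : ∫⁻ h, (ENNReal.ofReal (normSqVec (A *ᵥ h)))⁻¹ ∂(complexGaussianVec ι v) ≠ ⊤ := by
    rw [lintegral_inv_normSqVec_mulVec hA hv hm]
    exact ENNReal.ofReal_ne_top
  filter_upwards [ae_lt_top (by fun_prop) hfin] with h hh
  rwa [ENNReal.inv_lt_top, ENNReal.ofReal_pos] at hh

lemma notMem_span_of_normSqVec_pos {m : ℕ} {τ : Type*} {A : Matrix (Fin m) ι ℂ} {u : τ → ι → ℂ}
    (hA : ∀ j, A *ᵥ u j = 0) {h : ι → ℂ} (hh : 0 < normSqVec (A *ᵥ h)) :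
    h ∉ Submodule.span ℂ (Set.range u) := fun hmem => by
  have hker : Submodule.span ℂ (Set.range u) ≤ A.mulVecLin.ker :=
    Submodule.span_le.2 (by rintro _ ⟨j, rfl⟩; exact hA j)
  have : A *ᵥ h = 0 := hker hmem
  simp [this, normSqVec] at hh

lemma ae_insertNth {n : ℕ} {k : Fin (n + 1)} {u : Fin n → ι → ℂ} (hn : n + 2 ≤ Fintype.card ι)
    (hu : LinearIndependent ℂ u) {v : ℝ≥0} (hv : v ≠ 0) :
    ∀ᵐ h ∂(complexGaussianVec ι v),
      LinearIndependent ℂ (k.insertNth h u : Fin (n + 1) → ι → ℂ) := by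
  obtain ⟨m, A, hA, hA0, -, hle, -⟩ := exists_orthogonal_complement_matrix u
  rw [Fintype.card_fin] at hle
  filter_upwards [ae_normSqVec_mulVec_pos hA hv (by omega)] with h hh
  exact linearIndependent_insertNth k hu (notMem_span_of_normSqVec_pos hA0 hh)

lemma measurePreserving_insertNth {n : ℕ} (k : Fin (n + 1)) (ξ : Fin (n + 1) → ℝ≥0) :
    MeasurePreserving (fun p : (ι → ℂ) × (Fin n → ι → ℂ) =>
        (k.insertNth p.1 p.2 : Fin (n + 1) → ι → ℂ))
      ((complexGaussianVec ι (ξ k)).prod (channelLaw ι fun j => ξ (k.succAbove j)))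
      (channelLaw ι ξ) :=
  (measurePreserving_piFinSuccAbove (fun k => complexGaussianVec ι (ξ k)) k).symm

/-- Fewer independent complex Gaussian channels than antennas are almost surely linearly
independent. -/
theorem ae_linearIndependent {K : ℕ} (ξ : Fin K → ℝ≥0) (hξ : ∀ k, ξ k ≠ 0)
    (hK : K < Fintype.card ι) : ∀ᵐ M ∂(channelLaw ι ξ), LinearIndependent ℂ M := by
  induction K with
  | zero => exact ae_of_all _ fun M => linearIndependent_empty_type
  | succ n ih =>
    have hmp := measurePreserving_insertNth (ι := ι) 0 ξ
    have hset : MeasurableSet {p : (ι → ℂ) × (Fin n → ι → ℂ) | LinearIndependent ℂ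
        (Fin.insertNth 0 p.1 p.2 : Fin (n + 1) → ι → ℂ)} :=
      hmp.measurable measurableSet_linearIndependent
    -- Fubini for null sets, exchanged so that the other `n` channels are fixed before the new one
    -- is drawn.
    rw [← hmp.map_eq, ae_map_iff hmp.measurable.aemeasurable measurableSet_linearIndependent,
      Measure.ae_prod_iff_ae_ae hset, Measure.ae_ae_comm hset]
    filter_upwards [ih (fun j => ξ ((0 : Fin (n + 1)).succAbove j)) (fun j => hξ _) (by omega)]
      with u hu
    exact ae_insertNth (by omega) hu (hξ 0)

/-- The expected squared norm of a zero-forcing beamformer. -/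
theorem lintegral_normSqVec_zfCol {K : ℕ} (ξ : Fin K → ℝ≥0) (hξ : ∀ k, ξ k ≠ 0)
    (hK : K < Fintype.card ι) (k : Fin K) :
    ∫⁻ M, ENNReal.ofReal (normSqVec (zfCol k M)) ∂(channelLaw ι ξ) =
      ENNReal.ofReal (1 / (ξ k * ((Fintype.card ι : ℝ) - K))) := by
  obtain ⟨n, rfl⟩ : ∃ n, K = n + 1 := ⟨K - 1, by have := k.pos; omega⟩
  have hmp := measurePreserving_insertNth (ι := ι) k ξ
  have hmeas : Measurable fun p : (ι → ℂ) × (Fin n → ι → ℂ) =>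
      ENNReal.ofReal (normSqVec (zfCol k (k.insertNth p.1 p.2 : Fin (n + 1) → ι → ℂ))) :=
    Measurable.comp (g := fun M => ENNReal.ofReal (normSqVec (zfCol k M))) (by fun_prop)
      hmp.measurable
  -- Condition on the other channels: the integral over channel `k` is the inner one, and it turns
  -- out not to depend on them.
  rw [← hmp.lintegral_comp (by fun_prop), lintegral_prod_symm _ hmeas.aemeasurable]
  have hae := ae_linearIndependent (ι := ι) (fun j => ξ (k.succAbove j)) (fun j => hξ _) (by omega)
  rw [lintegral_congr_ae (g := fun _ => ENNReal.ofReal (1 / (ξ k * ((Fintype.card ι : ℝ) -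
    (n + 1 : ℕ)))))]
  · simp
  filter_upwards [hae] with u hu
  obtain ⟨m, A, hA, hA0, hA1, -, hm⟩ := exists_orthogonal_complement_matrix u
  have hm := hm hu
  rw [Fintype.card_fin] at hm
  -- The complement of `K - 1` channels has dimension `m = Nt - K + 1`, and `K < Nt` gives the `m ≥
  -- 2` needed for a finite moment.
  have hcard : (Fintype.card ι : ℝ) - (n + 1 : ℕ) = (m : ℝ) - 1 := by
    rw [hm]; push_cast; ring
  rw [hcard, ← lintegral_inv_normSqVec_mulVec hA (hξ k) (by omega)]
  refine lintegral_congr_ae ?_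
  filter_upwards [ae_normSqVec_mulVec_pos hA (hξ k) (by omega)] with h hh
  have hLI := linearIndependent_insertNth k hu (notMem_span_of_normSqVec_pos hA0 hh)
  have hprod := normSqVec_zfCol k hLI (A := A) (by simpa using hA0) (by simpa using hA1)
  rw [Fin.insertNth_apply_same] at hprod
  rw [← ENNReal.ofReal_inv_of_pos hh, eq_inv_of_mul_eq_one_left hprod]

/-- First and second moments of the zero-forcing beamformers. -/
theorem moments_zfCol [DecidableEq ι] {K : ℕ} (ξ : Fin K → ℝ≥0) (hξ : ∀ k, ξ k ≠ 0)
    (hK : K < Fintype.card ι) (k : Fin K) :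
    (∀ i, MemLp (fun M => zfCol k M i) 2 (channelLaw ι ξ)) ∧
      (∀ i, ∫ M, zfCol k M i ∂(channelLaw ι ξ) = 0) ∧
      ∀ i j, ∫ M, zfCol k M i * star (zfCol k M j) ∂(channelLaw ι ξ) =
        if i = j then ((xiBf .ZF (Fintype.card ι) ξ k : ℝ) : ℂ) else 0 := by
  have hmeas : Measurable (zfCol k : (Fin K → ι → ℂ) → ι → ℂ) := measurable_zfCol k
  have hprob : IsProbabilityMeasure ((channelLaw ι ξ).map (zfCol k)) :=
    Measure.isProbabilityMeasure_map hmeas.aemeasurable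
  have hK' : (0 : ℝ) < (Fintype.card ι : ℝ) - K := sub_pos.2 (by exact_mod_cast hK)
  have hinv : ∀ A : Matrix ι ι ℂ, A * Aᴴ = 1 →
      ((channelLaw ι ξ).map (zfCol k)).map (fun x => A *ᵥ x) = (channelLaw ι ξ).map (zfCol k) :=
    fun A hA => by
    have hmp : MeasurePreserving (fun (M : Fin K → ι → ℂ) j => A *ᵥ M j) (channelLaw ι ξ)
        (channelLaw ι ξ) :=
      measurePreserving_pi _ _ fun j => ⟨by fun_prop, map_mulVec_complexGaussianVec (ξ j) hA⟩
    have hcont : Measurable (fun x : ι → ℂ => A *ᵥ x) := by fun_prop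
    rw [Measure.map_map hcont hmeas]
    conv_rhs => rw [← hmp.map_eq, Measure.map_map hmeas hmp.measurable]
    congr 1
    funext M
    exact (zfCol_mulVec k hA M).symm
  obtain ⟨h1, h2, h3⟩ := moments_of_unitary_invariant hinv
    (s := 1 / (ξ k * ((Fintype.card ι : ℝ) - K))) (by positivity)
    (by rw [lintegral_map (by fun_prop) hmeas]; exact lintegral_normSqVec_zfCol ξ hξ hK k)
  refine ⟨fun i => (h1 i).comp_of_map hmeas.aemeasurable, fun i => ?_, fun i j => ?_⟩
  · rw [← h2 i, integral_map hmeas.aemeasurable (Measurable.aestronglyMeasurable (by fun_prop))]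
  · have h := h3 i j
    rw [integral_map hmeas.aemeasurable (Measurable.aestronglyMeasurable (by fun_prop))] at h
    rw [h]
    congr 3
    simp only [xiBf]
    rw [div_div, one_div_mul_one_div]
    ring

/-- First and second moments of a complex Gaussian vector. -/
theorem moments_complexGaussianVec [DecidableEq ι] (v : ℝ≥0) :
    (∀ i, MemLp (fun x : ι → ℂ => x i) 2 (complexGaussianVec ι v)) ∧
      (∀ i, ∫ x, x i ∂(complexGaussianVec ι v) = 0) ∧
      ∀ i j, ∫ x, x i * star (x j) ∂(complexGaussianVec ι v) =
        if i = j then ((v : ℝ) : ℂ) else 0 := by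
  obtain ⟨h1, h2, h3⟩ := moments_of_unitary_invariant
    (fun A hA => map_mulVec_complexGaussianVec v hA) (by positivity)
    (lintegral_normSqVec (ι := ι) v)
  refine ⟨h1, h2, fun i j => ?_⟩
  have hcard : (Fintype.card ι : ℝ) ≠ 0 := by exact_mod_cast (Fintype.card_pos_iff.2 ⟨i⟩).ne'
  rw [h3, mul_div_cancel_left₀ _ hcard]

end ZeroForcingLaw

/-! ### The transmit covariance -/

lemma integrable_mul_star {Ω : Type*} [MeasurableSpace Ω] {P : Measure Ω} {f g : Ω → ℂ}
    (hf : MemLp f 2 P) (hg : MemLp g 2 P) : Integrable (fun ω => f ω * star (g ω)) P :=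
  hf.integrable_mul hg.star

/-- Second moments of a random matrix times independent white symbols. -/
theorem integral_mul_mul_conjTranspose {Ω : Type*} [MeasurableSpace Ω] {P : Measure Ω} {ι : Type*}
    {K L : ℕ} {F : Ω → Matrix ι (Fin K) ℂ} {S : Ω → Matrix (Fin K) (Fin L) ℂ}
    (hF : ∀ i k, MemLp (fun ω => F ω i k) 2 P) (hS : ∀ k l, MemLp (fun ω => S ω k l) 2 P)
    (hSS : ∀ l k k', ∫ ω, S ω k l * star (S ω k' l) ∂P = if k = k' then 1 else 0)
    (hind : ∀ i j k k' l, IndepFun (fun ω => F ω i k * star (F ω j k'))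
      (fun ω => S ω k l * star (S ω k' l)) P) (i j : ι) :
    Integrable (fun ω => (F ω * S ω * (F ω * S ω)ᴴ) i j) P ∧
      ∫ ω, (F ω * S ω * (F ω * S ω)ᴴ) i j ∂P =
        L * ∑ k, ∫ ω, F ω i k * star (F ω j k) ∂P := by
  have hexp : ∀ ω, (F ω * S ω * (F ω * S ω)ᴴ) i j =
      -- Grouping precoder and symbol factors lets independence apply termwise; whiteness then keeps
      -- only `k = k'`.
      ∑ l, ∑ k, ∑ k', F ω i k * star (F ω j k') * (S ω k l * star (S ω k' l)) := fun ω => by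
    rw [Matrix.mul_apply]
    refine Finset.sum_congr rfl fun l _ => ?_
    rw [Matrix.conjTranspose_apply, Matrix.mul_apply, Matrix.mul_apply, star_sum,
      Finset.sum_mul_sum]
    refine Finset.sum_congr rfl fun k _ => Finset.sum_congr rfl fun k' _ => ?_
    rw [star_mul]
    ring
  have hFi : ∀ k k', Integrable (fun ω => F ω i k * star (F ω j k')) P := fun k k' =>
    integrable_mul_star (hF i k) (hF j k')
  have hSi : ∀ k k' l, Integrable (fun ω => S ω k l * star (S ω k' l)) P := fun k k' l =>
    integrable_mul_star (hS k l) (hS k' l)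
  have hint : ∀ l k k', Integrable
      (fun ω => F ω i k * star (F ω j k') * (S ω k l * star (S ω k' l))) P := fun l k k' =>
    (hind i j k k' l).integrable_mul (hFi k k') (hSi k k' l)
  simp only [hexp]
  refine ⟨integrable_finsetSum _ fun l _ => integrable_finsetSum _ fun k _ =>
    integrable_finsetSum _ fun k' _ => hint l k k', ?_⟩
  rw [integral_finsetSum _ fun l _ => integrable_finsetSum _ fun k _ =>
    integrable_finsetSum _ fun k' _ => hint l k k']
  have hl : ∀ l, ∫ ω, (∑ k, ∑ k', F ω i k * star (F ω j k') * (S ω k l * star (S ω k' l))) ∂P =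
      ∑ k, ∫ ω, F ω i k * star (F ω j k) ∂P := fun l => by
    rw [integral_finsetSum _ fun k _ => integrable_finsetSum _ fun k' _ => hint l k k']
    refine Finset.sum_congr rfl fun k _ => ?_
    rw [integral_finsetSum _ fun k' _ => hint l k k']
    have hk' : ∀ k', ∫ ω, F ω i k * star (F ω j k') * (S ω k l * star (S ω k' l)) ∂P =
        (∫ ω, F ω i k * star (F ω j k') ∂P) * if k = k' then 1 else 0 := fun k' => by
      rw [← hSS l k k']
      exact (hind i j k k' l).integral_fun_mul_eq_mul_integral (hFi k k').aestronglyMeasurable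
        (hSi k k' l).aestronglyMeasurable
    simp only [hk']
    simp
  simp only [hl]
  simp

/-! ### Second moments of the precoder columns. -/

section Covariance

variable {Ω : Type*} [MeasurableSpace Ω] {P : Measure Ω} [IsProbabilityMeasure P]
  {ι : Type*} [Fintype ι] {K : ℕ}

lemma hasLaw_channelLaw {ξ : Fin K → ℝ≥0} {H : Ω → Matrix ι (Fin K) ℂ}
    (hH : ∀ k, HasLaw (fun ω i => H ω i k) (complexGaussianVec ι (ξ k)) P)
    (hind : iIndepFun (fun (k : Fin K) (ω : Ω) (i : ι) => H ω i k) P) :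
    HasLaw (fun ω k i => H ω i k) (channelLaw ι ξ) P where
  aemeasurable := aemeasurable_pi_lambda _ fun k => (hH k).aemeasurable
  map_eq := by
    rw [(iIndepFun_iff_map_fun_eq_pi_map fun k => (hH k).aemeasurable).1 hind, channelLaw]
    congr 1
    funext k
    exact (hH k).map_eq

/-- First and second moments of the columns of the communications precoder. -/
theorem moments_commPrecoder [DecidableEq ι] (bf : Scheme) {ξ : Fin K → ℝ≥0} (hξ : ∀ k, 0 < ξ k)
    {H : Ω → Matrix ι (Fin K) ℂ}
    (hH : ∀ k, HasLaw (fun ω i => H ω i k) (complexGaussianVec ι (ξ k)) P)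
    (hZF : bf = Scheme.ZF → K < Fintype.card ι ∧
      iIndepFun (fun (k : Fin K) (ω : Ω) (i : ι) => H ω i k) P) (k : Fin K) :
    (∀ i, MemLp (fun ω => commPrecoder bf (H ω) i k) 2 P) ∧
      (∀ i, ∫ ω, commPrecoder bf (H ω) i k ∂P = 0) ∧
      ∀ i j, ∫ ω, commPrecoder bf (H ω) i k * star (commPrecoder bf (H ω) j k) ∂P =
        if i = j then ((xiBf bf (Fintype.card ι) ξ k : ℝ) : ℂ) else 0 := by
  cases bf with
  | MRT =>
    obtain ⟨h1, h2, h3⟩ := moments_complexGaussianVec (ι := ι) (ξ k)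
    have ha := (hH k).aemeasurable
    rw [← (hH k).map_eq] at h1 h2 h3
    refine ⟨fun i => (h1 i).comp_of_map ha, fun i => ?_, fun i j => ?_⟩
    · rw [← h2 i, integral_map ha (Measurable.aestronglyMeasurable (by fun_prop))]
      rfl
    · have h := h3 i j
      rw [integral_map ha (Measurable.aestronglyMeasurable (by fun_prop))] at h
      exact h
  | ZF =>
    obtain ⟨hK, hind⟩ := hZF rfl
    obtain ⟨h1, h2, h3⟩ := moments_zfCol ξ (fun k => (hξ k).ne') hK k
    have hlaw := hasLaw_channelLaw hH hind
    have ha := hlaw.aemeasurable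
    rw [← hlaw.map_eq] at h1 h2 h3
    refine ⟨fun i => (h1 i).comp_of_map ha, fun i => ?_, fun i j => ?_⟩
    · rw [← h2 i, integral_map ha (Measurable.aestronglyMeasurable (by fun_prop))]
      rfl
    · have h := h3 i j
      rw [integral_map ha (Measurable.aestronglyMeasurable (by fun_prop))] at h
      exact h

/-- Lets independence of the channel estimate and the symbols pass to the precoder. -/
lemma measurable_commPrecoder (bf : Scheme) (i : ι) (k : Fin K) :
    Measurable fun h : ι → Fin K → ℂ => commPrecoder bf (Matrix.of h) i k := by
  cases bf with
  | MRT => exact (measurable_pi_apply k).comp (measurable_pi_apply i)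
  | ZF =>
    have hswap : Measurable fun (h : ι → Fin K → ℂ) (k : Fin K) (i : ι) => h i k := by fun_prop
    exact (measurable_pi_apply i).comp ((measurable_zfCol k).comp hswap)

lemma precoder_apply (bf : Scheme) (γ η : Fin K → ℝ) (v : ι → ℂ) (H : Matrix ι (Fin K) ℂ) (i : ι)
    (k : Fin K) : precoder bf γ η v H i k =
      commPrecoder bf H i k * (√(γ k) : ℂ) + v i * (√(η k) : ℂ) := by
  simp [precoder, Matrix.vecMulVec_apply]

lemma measurable_precoder (bf : Scheme) (γ η : Fin K → ℝ) (v : ι → ℂ) (i : ι) (k : Fin K) :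
    Measurable fun h : ι → Fin K → ℂ => precoder bf γ η v (Matrix.of h) i k := by
  simp only [precoder_apply]
  exact ((measurable_commPrecoder bf i k).mul_const _).add_const _

lemma ofReal_sqrt_mul_self {x : ℝ} (hx : 0 ≤ x) : (√x : ℂ) * (√x : ℂ) = x := by
  rw [← Complex.ofReal_mul, Real.mul_self_sqrt hx]

/-- Second moments of an affine image of centred random variables. -/
lemma integral_affine_mul_star {f g : Ω → ℂ} (hf : MemLp f 2 P) (hg : MemLp g 2 P)
    (hf0 : ∫ ω, f ω ∂P = 0) (hg0 : ∫ ω, g ω ∂P = 0) (s t : ℝ) (x y : ℂ) :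
    ∫ ω, (f ω * s + x * t) * star (g ω * s + y * t) ∂P =
      s * s * ∫ ω, f ω * star (g ω) ∂P + t * t * (x * star y) := by
  have hg' : ∫ ω, star (g ω) ∂P = 0 := by
    have h : ∫ ω, star (g ω) ∂P = star (∫ ω, g ω ∂P) := integral_conj
    rw [h, hg0, star_zero]
  have hi1 : Integrable (fun ω => (s * s : ℂ) * (f ω * star (g ω))) P :=
    (integrable_mul_star hf hg).const_mul _
  have hi2 : Integrable (fun ω => s * t * star y * f ω) P :=
    (hf.integrable one_le_two).const_mul _
  have hi3 : Integrable (fun ω => s * t * x * star (g ω)) P :=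
    (hg.star.integrable one_le_two).const_mul _
  have hi12 : Integrable (fun ω => (s * s : ℂ) * (f ω * star (g ω)) + s * t * star y * f ω) P :=
    hi1.add hi2
  have hi123 : Integrable (fun ω => (s * s : ℂ) * (f ω * star (g ω)) + s * t * star y * f ω +
      s * t * x * star (g ω)) P := hi12.add hi3
  -- The two middle terms are linear in a centred variable and integrate to zero.
  have hexp : ∀ ω, (f ω * s + x * t) * star (g ω * s + y * t) =
      (s * s : ℂ) * (f ω * star (g ω)) + s * t * star y * f ω + s * t * x * star (g ω) +
        t * t * (x * star y) := fun ω => by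
    simp only [star_add, star_mul, Complex.star_def, Complex.conj_ofReal]
    ring
  simp only [hexp]
  rw [integral_add hi123 (integrable_const _), integral_add hi12 hi3, integral_add hi1 hi2,
    integral_const_mul, integral_const_mul, integral_const_mul, hf0, hg']
  simp

/-- The second moments of the columns of the dual-functional precoder. -/
theorem moments_precoder [DecidableEq ι] (bf : Scheme) {ξ : Fin K → ℝ≥0} (hξ : ∀ k, 0 < ξ k)
    {γ η : Fin K → ℝ} (hγ : ∀ k, 0 ≤ γ k) (hη : ∀ k, 0 ≤ η k) (v : ι → ℂ)
    {H : Ω → Matrix ι (Fin K) ℂ}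
    (hH : ∀ k, HasLaw (fun ω i => H ω i k) (complexGaussianVec ι (ξ k)) P)
    (hZF : bf = Scheme.ZF → K < Fintype.card ι ∧
      iIndepFun (fun (k : Fin K) (ω : Ω) (i : ι) => H ω i k) P) (k : Fin K) :
    (∀ i, MemLp (fun ω => precoder bf γ η v (H ω) i k) 2 P) ∧
      ∀ i j, ∫ ω, precoder bf γ η v (H ω) i k * star (precoder bf γ η v (H ω) j k) ∂P =
        ((xiBf bf (Fintype.card ι) ξ k * γ k : ℝ) : ℂ) * (1 : Matrix ι ι ℂ) i j +
          (η k : ℂ) * (v i * star (v j)) := by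
  obtain ⟨h1, h2, h3⟩ := moments_commPrecoder bf hξ hH hZF k
  simp only [precoder_apply]
  refine ⟨fun i => ((h1 i).mul_const _).add (memLp_const _), fun i j => ?_⟩
  rw [integral_affine_mul_star (h1 i) (h1 j) (h2 i) (h2 j), h3, Matrix.one_apply,
    ofReal_sqrt_mul_self (hγ k), ofReal_sqrt_mul_self (hη k)]
  push_cast
  split_ifs <;> ring

lemma xiBf_pos (bf : Scheme) {N : ℕ} {ξ : Fin K → ℝ≥0} (hξ : ∀ k, 0 < ξ k)
    (hK : bf = Scheme.ZF → K < N) (k : Fin K) : 0 < xiBf bf N ξ k := by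
  have hξk : (0 : ℝ) < ξ k := NNReal.coe_pos.2 (hξ k)
  cases bf with
  | MRT => exact hξk
  | ZF =>
    have h1 : (K : ℝ) < N := by exact_mod_cast hK rfl
    have h2 : (0 : ℝ) < (N : ℝ) - K := sub_pos.2 h1
    have h3 : (0 : ℝ) < N := (Nat.cast_nonneg K).trans_lt h1
    simp only [xiBf]
    positivity

end Covariance

end ISAC

/-! ### Assembly of the main theorem. -/

theorem theorem2
    {Ω : Type*} [MeasurableSpace Ω] (P : Measure Ω) [IsProbabilityMeasure P]
    (Nth Ntv Nrh Nrv K L : ℕ) (hL : 0 < L) (bf : ISAC.Scheme)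
    (ξ : Fin K → ℝ≥0) (hξ : ∀ k, 0 < ξ k)
    (γ η : Fin K → ℝ) (hγ : ∀ k, 0 ≤ γ k) (hη : ∀ k, 0 ≤ η k)
    (θ φ θ' φ' : ℝ) (α : ℂ) (σ2 : ℝ) (hσ2 : 0 < σ2)
    -- the channel estimates, with columns distributed as `CN(0, ξ k I)`
    (H : Ω → Matrix (Fin Nth × Fin Ntv) (Fin K) ℂ)
    (hH : ∀ k, HasLaw (fun ω i => H ω i k)
      (ISAC.complexGaussianVec (Fin Nth × Fin Ntv) (ξ k)) P)
    (hZF : bf = ISAC.Scheme.ZF →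
      K < Nth * Ntv ∧ iIndepFun (fun (k : Fin K) (ω : Ω) (i : Fin Nth × Fin Ntv) => H ω i k) P)
    -- the data symbols
    (S : Ω → Matrix (Fin K) (Fin L) ℂ)
    (hS : ∀ k l, MemLp (fun ω => S ω k l) 2 P)
    (hSS : ∀ l k k', ∫ ω, S ω k l * star (S ω k' l) ∂P = if k = k' then 1 else 0)
    (hHS : IndepFun (fun (ω : Ω) (i : Fin Nth × Fin Ntv) (k : Fin K) => H ω i k)
      (fun (ω : Ω) (k : Fin K) (l : Fin L) => S ω k l) P) :
    let Nt : ℝ := (Nth : ℝ) * (Ntv : ℝ)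
    let Nr : ℝ := (Nrh : ℝ) * (Nrv : ℝ)
    let ρ : ℝ := ∑ k, η k
    let κ : ℝ := 2 * (L : ℝ) / σ2
    let ξγ : ℝ := ISAC.xiBf bf (Nth * Ntv) ξ ⬝ᵥ γ
    let v := ISAC.steer Nth Ntv θ' φ'
    let a := ISAC.steer Nth Ntv θ φ
    let aθ := ISAC.steerDerivAz Nth Ntv θ φ
    let aφ := ISAC.steerDerivEl Nth Ntv θ φ
    let bθ := ISAC.steerDerivAz Nrh Nrv θ φ
    let bφ := ISAC.steerDerivEl Nrh Nrv θ φ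
    let F := fun ω => ISAC.precoder bf γ η v (H ω)
    let X := fun ω => F ω * S ω
    let J := ISAC.fisher Nrh Nrv P X σ2 θ φ α
    -- the transmit covariance
    ((∀ i j, Integrable (fun ω => (F ω * (F ω)ᴴ) i j) P) ∧
      (∀ i j, Integrable (fun ω => (X ω * (X ω)ᴴ) i j) P) ∧
      ISAC.transmitCov P X = ISAC.precoderCov P F ∧
      ISAC.precoderCov P F = (ξγ : ℂ) • 1 + (ρ : ℂ) • Matrix.vecMulVec v (star v)) ∧
    -- the entries of the Fisher information matrix
    (J 0 0 = κ * ‖α‖ ^ 2 *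
        (ξγ * (Nr * ISAC.normSqVec aθ + Nt * ISAC.normSqVec bθ) +
          ρ * (‖ISAC.herm v a‖ ^ 2 * ISAC.normSqVec bθ + Nr * ‖ISAC.herm v aθ‖ ^ 2)) ∧
      J 1 1 = κ * ‖α‖ ^ 2 *
        (ξγ * (Nr * ISAC.normSqVec aφ + Nt * ISAC.normSqVec bφ) +
          ρ * (‖ISAC.herm v a‖ ^ 2 * ISAC.normSqVec bφ + Nr * ‖ISAC.herm v aφ‖ ^ 2)) ∧
      ((J 0 1 : ℝ) : ℂ) = (κ : ℂ) * (‖α‖ : ℂ) ^ 2 *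
        ((ξγ : ℂ) * ((Nr : ℂ) * ISAC.herm aθ aφ + (Nt : ℂ) * ISAC.herm bθ bφ) +
          (ρ : ℂ) * ((‖ISAC.herm v a‖ : ℂ) ^ 2 * ISAC.herm bφ bθ +
            (Nr : ℂ) * (ISAC.herm aθ v * ISAC.herm v aφ))) ∧
      J 1 0 = J 0 1 ∧
      ISAC.jAlphaAlpha J =
        (κ * (ξγ * Nt * Nr + ρ * Nr * ‖ISAC.herm v a‖ ^ 2)) • (1 : Matrix (Fin 2) (Fin 2) ℝ) ∧
      ISAC.jPhiAlpha J = fun m : Fin 2 => κ * ρ * Nr *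
        (star α * (ISAC.herm a v * ISAC.herm v aφ) * (![1, Complex.I] : Fin 2 → ℂ) m).re) ∧
    -- the bounds for azimuth and elevation
    (IsUnit (ISAC.jAlphaAlpha J) → IsUnit (ISAC.equivFisher J) →
      (ISAC.jTilde J ≠ 0 →
        ISAC.crlbAz J = (J 0 0 - (J 0 1) ^ 2 / ISAC.jTilde J)⁻¹) ∧
      (J 0 0 ≠ 0 →
        ISAC.crlbEl J = (ISAC.jTilde J - (J 0 1) ^ 2 / J 0 0)⁻¹)) ∧
    -- all denominators are nonzero once some communications power is used
    ((∃ k, 0 < γ k) → IsUnit (ISAC.equivFisher J) →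
      IsUnit (ISAC.jAlphaAlpha J) ∧ ISAC.jTilde J ≠ 0 ∧ J 0 0 ≠ 0) := by
  intro Nt Nr ρ κ ξγ v a aθ aφ bθ bφ F X J
  have hcard : Fintype.card (Fin Nth × Fin Ntv) = Nth * Ntv := by simp
  have hZF' : bf = ISAC.Scheme.ZF → K < Fintype.card (Fin Nth × Fin Ntv) ∧
      iIndepFun (fun (k : Fin K) (ω : Ω) (i : Fin Nth × Fin Ntv) => H ω i k) P := by
    rwa [hcard]
  have hF := fun k => ISAC.moments_precoder bf hξ hγ hη v hH hZF' k
  rw [hcard] at hF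
  have hind : ∀ i j k k' l, IndepFun (fun ω => F ω i k * star (F ω j k'))
      (fun ω => S ω k l * star (S ω k' l)) P := fun i j k k' l =>
    hHS.comp
      (φ := fun h : Fin Nth × Fin Ntv → Fin K → ℂ => ISAC.precoder bf γ η v (Matrix.of h) i k *
        star (ISAC.precoder bf γ η v (Matrix.of h) j k'))
      (ψ := fun s : Fin K → Fin L → ℂ => s k l * star (s k' l))
      ((ISAC.measurable_precoder bf γ η v i k).mul
        (continuous_star.measurable.comp (ISAC.measurable_precoder bf γ η v j k')))
      (by fun_prop)
  have hXX := fun i j => ISAC.integral_mul_mul_conjTranspose (fun i k => (hF k).1 i) hS hSS hind i j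
  have hFF : ∀ ω i j, (F ω * (F ω)ᴴ) i j = ∑ k, F ω i k * star (F ω j k) := fun ω i j => by
    rw [Matrix.mul_apply]; rfl
  have hFint : ∀ i j k, Integrable (fun ω => F ω i k * star (F ω j k)) P := fun i j k =>
    ISAC.integrable_mul_star ((hF k).1 i) ((hF k).1 j)
  -- `F Fᴴ` is a sum over single columns, so their joint law is irrelevant here.
  have hcovF : ∀ i j, ISAC.precoderCov P F i j = ∑ k, ∫ ω, F ω i k * star (F ω j k) ∂P :=
    fun i j => by
    simp only [ISAC.precoderCov, ISAC.matExp, Matrix.of_apply, hFF]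
    exact integral_finsetSum _ fun k _ => hFint i j k
  have hFcl : ISAC.precoderCov P F = (ξγ : ℂ) • 1 + (ρ : ℂ) • Matrix.vecMulVec v (star v) := by
    ext i j
    rw [hcovF, Finset.sum_congr rfl fun k _ => (hF k).2 i j, Finset.sum_add_distrib,
      ← Finset.sum_mul, ← Finset.sum_mul, ← Complex.ofReal_sum, ← Complex.ofReal_sum]
    rfl
  have hTF : ISAC.transmitCov P X = ISAC.precoderCov P F := by
    ext i j
    have hL' : (L : ℂ) ≠ 0 := by exact_mod_cast hL.ne'
    rw [hcovF, ISAC.transmitCov, Matrix.smul_apply, ISAC.matExp, Matrix.of_apply, (hXX i j).2,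
      smul_eq_mul, ← mul_assoc, one_div_mul_cancel hL', one_mul]
  have hXint : ∀ i j, Integrable (fun ω => (X ω * (X ω)ᴴ) i j) P := fun i j => (hXX i j).1
  have hFFint : ∀ i j, Integrable (fun ω => (F ω * (F ω)ᴴ) i j) P := fun i j => by
    simp only [hFF]
    exact integrable_finsetSum _ fun k _ => hFint i j k
  refine ⟨⟨hFFint, hXint, hTF, hFcl⟩,
    ISAC.fisher_entries hL hXint σ2 θ φ θ' φ' α ξγ ρ (hTF.trans hFcl),
    fun _ _ => ⟨ISAC.crlbAz_eq_schur, ISAC.crlbEl_eq_schur⟩, fun ⟨k, hk⟩ hJ => ?_⟩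
  -- One active communications power makes the isotropic part strictly positive.
  have hξγ : 0 < ξγ :=
    Finset.sum_pos' (fun k _ => mul_nonneg
      (ISAC.xiBf_pos bf hξ (fun h => (hZF h).1) k).le (hγ k))
      ⟨k, Finset.mem_univ k, mul_pos (ISAC.xiBf_pos bf hξ (fun h => (hZF h).1) k) hk⟩
  exact ISAC.denominators_ne_zero hL hXint hσ2 θ φ θ' φ' α (Finset.sum_nonneg fun k _ => hη k)
    hξγ (hTF.trans hFcl) hJ
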